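/- **Conventions.** $[w]$ is a set of $w$ states; $U_n$ is the uniform distribution on $\{0,1\}^n$; $\log$ is to base $2$. A $(w,d)$-automaton is a function $Q:[w]\times\{0,1\}^d\to[w]$, and $Q^m(q;y)$ is the state reached from $q$ after $Q$ reads the $m$ consecutive $d$-bit blocks of $y\in\{0,1\}^{md}$. $\mathbf{Q}^m_{w,d}$ is the class of functions $y\mapsto Q^m(q;y)$ from $\{0,1\}^{md}$ to $[w]$, each presented by a pair $(Q,q)$. A function $\mathsf{Sim}$ taking a pair $(Q,q)$ and a seed $x\in\{0,1\}^s$ to an element of $[w]$ is an *$\epsilon$-simulator for $\mathbf{Q}^m_{w,d}$ with seed length $s$* if for every $(Q,q)$ the total variation distance between $\mathsf{Sim}(Q,q,U_s)$ and $Q^m(q;U_{md})$ is at most $\epsilon$. A function $\mathsf{Gen}$ taking $(Q,q)$ and $x\in\{0,1\}^s$ to an element of $\{0,1\}^{md}$ is a *targeted $\epsilon$-pseudorandom generator against $\mathbf{Q}^m_{w,d}$ with seed length $s$* if $(Q,q,x)\mapsto Q^m(q;\mathsf{Gen}(Q,q,x))$ is an $\epsilon$-simulator for $\mathbf{Q}^m_{w,d}$.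 A *deterministic Ladner–Lynch oracle algorithm* is a deterministic multitape Turing machine with a two-way read-only input tape, finitely many work tapes, a write-only output tape and a write-only oracle tape. To consult an oracle $f$ (a function from strings to bit strings) it writes an index $i$ and a query string $y$ on the oracle tape; the bit $f(y)_i$ (or the information that there is no such bit) is stored in the finite control and the oracle tape is erased. Space is the number of work-tape cells used; the input, output and oracle tapes are not counted. An oracle for a simulator $\mathsf{Sim}$ is a function $f$ that maps the encoding of each triple $(Q,q,x)$ ($Q$ given by its transition table) to the binary representation of $\mathsf{Sim}(Q,q,x)$. **Lemma.** There exist a single deterministic Ladner–Lynch oracle algorithm $\mathsf{G}$ and a constant $C$ such that the following holds for all integers $w,m\ge 1$ and $d,s\ge 0$ and every real $\epsilon$. If $\mathsf{Sim}$ is an $\epsilon$-simulator for $\mathbf{Q}^m_{wm,d}$ with seed length $s$, then, given any oracle for $\mathsf{Sim}$ and, as input, the parameters $w,d,m,s$ in binary together with $(Q,q,x)$, where $Q$ is a $(w,d)$-automaton, $q\in[w]$ and $x\in\{0,1\}^s$, the algorithm $\mathsf{G}$ halts and outputs a string $\mathsf{G}^{\mathsf{Sim}}(Q,q,x)\in\{0,1\}^{md}$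 such that: 1. $\mathsf{G}^{\mathsf{Sim}}$ is a targeted $(2mw^2\epsilon)$-pseudorandom generator against $\mathbf{Q}^m_{w,d}$ with seed length $s$; 2. on every such input, $\mathsf{G}$ uses at most $C\,(s+d+\log w+\log m+1)$ space, i.e. space $O(s+d+\log w+\log m)$. -/

import Mathlib

/-! ### Simulators and targeted pseudorandom generators -/

/-- Bit strings of length `n`. -/
abbrev BitString (n : ℕ) : Type := Fin n → Bool

/-- Total variation distance on a finite set, as half of the `L¹` distance. -/
noncomputable def tvDist {α : Type*} [Fintype α] (μ ν : PMF α) : ℝ :=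
  (1 / 2) * ∑ a, |(μ a).toReal - (ν a).toReal|

/-- The distribution of `g (U_n)`, where `U_n` is uniform on `{0,1}^n`. -/
noncomputable def uniformImage {n : ℕ} {α : Type*} (g : BitString n → α) : PMF α :=
  (PMF.uniformOfFintype (BitString n)).map g

/-- Let `F` be a family of functions `{0,1}^n → [w]`, each specified by an element of `ι`.
`Sim` is an `ε`-simulator for the family if `Sim (a, U_s)` is within total variation distance `ε`
of `F a (U_n)`, for every `a`. -/
def IsSimulator {ι : Type*} {n w s : ℕ} (ε : ℝ) (F : ι → BitString n → Fin w)
    (Sim : ι → BitString s → Fin w) : Prop :=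
  ∀ a : ι, tvDist (uniformImage (Sim a)) (uniformImage (F a)) ≤ ε

/-- `Gen` is a targeted `ε`-pseudorandom generator against the family `F`. -/
def IsTargetedPRG {ι : Type*} {n w s : ℕ} (ε : ℝ) (F : ι → BitString n → Fin w)
    (Gen : ι → BitString s → BitString n) : Prop :=
  IsSimulator ε F fun a x => F a (Gen a x)

/-- A `(w, d)`-automaton; the state set `[w]` is `Fin w`. -/
abbrev Automaton (w d : ℕ) : Type := Fin w → BitString d → Fin w

/-- `Q^m (q; x)`: the state reached from `q` after reading the `m` consecutive `d`-bit blocks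
of `x`, first block first. -/
def Automaton.run {w d : ℕ} (m : ℕ) (Q : Automaton w d) (q : Fin w) (x : BitString (m * d)) :
    Fin w :=
  Fin.foldl m (fun v i => Q v fun j => x (finProdFinEquiv (i, j))) q

/-- The class of functions `x ↦ Q^m (q; x)`, an element being specified by the pair `(Q, q)`. -/
def automatonClass (w d m : ℕ) (a : Automaton w d × Fin w) : BitString (m * d) → Fin w :=
  Automaton.run m a.1 a.2

/-! ### Encodings -/

/-- The alphabet of the input tape and of the oracle tape: the two bits and a separator. -/
inductive TapeSym : Type
  | bit (b : Bool)
  | sep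

/-- A natural number, in binary (least significant bit first), followed by a separator. -/
def encodeNat (n : ℕ) : List TapeSym :=
  n.bits.map TapeSym.bit ++ [TapeSym.sep]

/-- The bit string of length `d` whose `j`-th bit is the binary digit of `k` of weight `2^j`. -/
def bitStringOfNat (d k : ℕ) : BitString d := fun j => k.testBit j

/-- The transition table of an automaton. -/
def encodeAutomaton {w d : ℕ} (Q : Automaton w d) : List TapeSym :=
  (List.finRange w).flatMap fun v =>
    (List.range (2 ^ d)).flatMap fun k => encodeNat (Q v (bitStringOfNat d k))

/-- The encoding of a triple `(Q, q, x)`. -/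
def encodeInstance {w d s : ℕ} (Q : Automaton w d) (q : Fin w) (x : BitString s) : List TapeSym :=
  encodeAutomaton Q ++ encodeNat q ++ (List.ofFn x).map TapeSym.bit

/-- The triple `(Q, q, x)` preceded by the numerical parameters. -/
def encodeInput {w d s : ℕ} (m : ℕ) (Q : Automaton w d) (q : Fin w) (x : BitString s) :
    List TapeSym :=
  encodeNat w ++ encodeNat d ++ encodeNat m ++ encodeNat s ++ encodeInstance Q q x

/-! ### Deterministic oracle machines in the Ladner–Lynch model -/

/-- Head movements. -/
inductive HeadMove : Type
  | left
  | stay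
  | right

/-- What the head on the input tape can see: the input is delimited by two end markers. -/
inductive InputSym : Type
  | leftEnd
  | sym (a : TapeSym)
  | rightEnd

/-- What a machine does in one step. `act` writes and moves on all the work tapes, moves the input
head, and possibly appends a symbol to the write-only output tape and one to the write-only oracle
tape. `query` submits the oracle tape; the next state is determined by the answer. -/
inductive LLAction (State Tape Γ : Type) : Type
  | halt
  | act (next : State) (write : Tape → Γ) (move : Tape → HeadMove) (inputMove : HeadMove)
      (output : Option Bool) (oracle : Option TapeSym)
  | query (next : Option Bool → State)

/-- A deterministic oracle Turing machine: a finite control, a two-way read-only input tape, finitely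
many one-way infinite work tapes over a finite alphabet, a write-only output tape and a write-only
oracle tape. -/
structure LLMachine : Type 1 where
  State : Type
  Tape : Type
  Γ : Type
  finite_state : Finite State
  finite_tape : Finite Tape
  finite_alphabet : Finite Γ
  blank : Γ
  start : State
  δ : State → InputSym → (Tape → Γ) → LLAction State Tape Γ

/-- A query is a string over the tape alphabet: the binary digits of an index `i` (least significant
first), a separator, and then the query string proper. -/
def splitQuery : List TapeSym → List Bool × List TapeSym
  | [] => ([], [])
  | TapeSym.sep :: u => ([], u)
  | TapeSym.bit b :: u => (b :: (splitQuery u).1, (splitQuery u).2)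

/-- The answer of the oracle `f` to a query with index `i` and query string `y`: the `i`-th symbol
(counting from `0`) of `f y`, or `none` if `f y` is too short. -/
def oracleAnswer (f : List TapeSym → List Bool) (u : List TapeSym) : Option Bool :=
  (f (splitQuery u).2)[Nat.ofDigits 2 ((splitQuery u).1.map Bool.toNat)]?

namespace LLMachine

/-- A configuration; the contents of the output and oracle tapes are listed in the order in which
they were written. -/
structure Config (M : LLMachine) : Type where
  state : M.State
  inputHead : ℕ
  head : M.Tape → ℕ
  cell : M.Tape → ℕ → M.Γ
  oracleTape : List TapeSym
  output : List Bool

/-- The new position of a head; at the left end of a tape, a move to the left has no effect. -/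
def moveHead : HeadMove → ℕ → ℕ
  | HeadMove.left, p => p - 1
  | HeadMove.stay, p => p
  | HeadMove.right, p => p + 1

/-- The symbol at position `p` of the input tape: the left end marker is at position `0`, and the
right end marker at position `inp.length + 1`. -/
def scan (inp : List TapeSym) : ℕ → InputSym
  | 0 => InputSym.leftEnd
  | p + 1 => match inp[p]? with
    | some a => InputSym.sym a
    | none => InputSym.rightEnd

/-- The initial configuration: empty tapes, and all heads at the left. -/
def init (M : LLMachine) : M.Config where
  state := M.start
  inputHead := 0
  head := fun _ => 0
  cell := fun _ _ => M.blank
  oracleTape := []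
  output := []

/-- One step of `M` on the input `inp` with the oracle `f`; the result is `none` if `M` halts.
A query erases the oracle tape. -/
def step (M : LLMachine) (f : List TapeSym → List Bool) (inp : List TapeSym) (c : M.Config) :
    Option M.Config :=
  match M.δ c.state (scan inp c.inputHead) (fun t => c.cell t (c.head t)) with
  | LLAction.halt => none
  | LLAction.act next write move inputMove output oracle =>
    some
      { state := next
        inputHead := min (moveHead inputMove c.inputHead) (inp.length + 1)
        head := fun t => moveHead (move t) (c.head t)
        cell := fun t => Function.update (c.cell t) (c.head t) (write t)
        oracleTape := c.oracleTape ++ oracle.toList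
        output := c.output ++ output.toList }
  | LLAction.query next =>
    some { c with state := next (oracleAnswer f c.oracleTape), oracleTape := [] }

/-- With the oracle `f`, the machine `M` halts on the input `inp` with the output `out`. -/
def Computes (M : LLMachine) (f : List TapeSym → List Bool) (inp : List TapeSym) (out : List Bool) :
    Prop :=
  ∃ c : M.Config, StateTransition.Reaches (M.step f inp) M.init c ∧ M.step f inp c = none ∧
    c.output = out

/-- Throughout the computation, every work-tape head stays within the first `S` cells of its tape.
(The number of work tapes and the work alphabet do not depend on the input. The input, output and
oracle tapes are not counted.) -/
def UsesSpaceAtMost (M : LLMachine) (f : List TapeSym → List Bool) (inp : List TapeSym) (S : ℕ) : Prop :=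
  ∀ c : M.Config, StateTransition.Reaches (M.step f inp) M.init c → ∀ t, c.head t < S

end LLMachine

/-- The string function `f` is an oracle for the simulator `Sim`: on the encoding of `(Q, q, x)` it
returns `Sim (Q, q, x)` in binary. On other strings `f` is arbitrary. -/
def IsOracleFor {w d s : ℕ} (f : List TapeSym → List Bool)
    (Sim : Automaton w d × Fin w → BitString s → Fin w) : Prop :=
  ∀ (Q : Automaton w d) (q : Fin w) (x : BitString s),
    f (encodeInstance Q q x) = (Sim (Q, q) x : ℕ).bits

theorem splitQuery_encodeNat (n : ℕ) (u : List TapeSym) :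
    splitQuery (encodeNat n ++ u) = (n.bits, u) := by
  have h : ∀ l : List Bool, splitQuery (l.map TapeSym.bit ++ TapeSym.sep :: u) = (l, u) := by
    intro l
    induction l with
    | nil => rfl
    | cons b l ih => simp [splitQuery, ih]
  simpa [encodeNat] using h n.bits

/-- A query with index `i` and query string `y` is answered by `(f y)_i`. -/
theorem oracleAnswer_encodeNat (f : List TapeSym → List Bool) (i : ℕ) (y : List TapeSym) :
    oracleAnswer f (encodeNat i ++ y) = (f y)[i]? := by
  have h : Nat.ofDigits 2 (i.bits.map Bool.toNat) = i := by
    conv_rhs => rw [← Nat.ofDigits_digits 2 i, Nat.digits_two_eq_bits]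
    congr 2
  simp only [oracleAnswer, splitQuery_encodeNat, h]

theorem encodeNat_append_inj {a b : ℕ} {u v : List TapeSym}
    (h : encodeNat a ++ u = encodeNat b ++ v) : a = b ∧ u = v := by
  have h' := congrArg splitQuery h
  rw [splitQuery_encodeNat, splitQuery_encodeNat, Prod.mk.injEq] at h'
  refine ⟨?_, h'.2⟩
  have := congrArg (fun l : List Bool => l.map fun b => cond b 1 0) h'.1
  simp only [← Nat.digits_two_eq_bits] at this
  exact Nat.digits_inj_iff.1 this

theorem flatMap_append_inj {α β : Type*} {e e' : α → List β}
    (he : ∀ a u v, e a ++ u = e' a ++ v → e a = e' a ∧ u = v) :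
    ∀ (l : List α) (u v : List β), l.flatMap e ++ u = l.flatMap e' ++ v →
      (∀ a ∈ l, e a = e' a) ∧ u = v
  | [], u, v, h => ⟨by simp, by simpa using h⟩
  | a :: l, u, v, h => by
    simp only [List.flatMap_cons, List.append_assoc] at h
    obtain ⟨h1, h2⟩ := he _ _ _ h
    obtain ⟨h3, h4⟩ := flatMap_append_inj he l u v h2
    exact ⟨by simpa using ⟨h1, h3⟩, h4⟩

theorem exists_bitStringOfNat {d : ℕ} (z : BitString d) :
    ∃ k < 2 ^ d, bitStringOfNat d k = z := by
  refine ⟨Nat.ofBits z, Nat.ofBits_lt_two_pow z, ?_⟩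
  funext j
  simp [bitStringOfNat]

/-- Distinct triples have distinct encodings. -/
theorem encodeInstance_inj {w d s : ℕ} {Q Q' : Automaton w d} {q q' : Fin w} {x x' : BitString s}
    (h : encodeInstance Q q x = encodeInstance Q' q' x') : Q = Q' ∧ q = q' ∧ x = x' := by
  have henc : ∀ (a b : ℕ) (u v : List TapeSym), encodeNat a ++ u = encodeNat b ++ v →
      encodeNat a = encodeNat b ∧ u = v := fun a b u v h =>
    ⟨by rw [(encodeNat_append_inj h).1], (encodeNat_append_inj h).2⟩
  simp only [encodeInstance, encodeAutomaton, List.append_assoc] at h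
  obtain ⟨h1, h2⟩ := flatMap_append_inj (fun v u u' hu => by
    obtain ⟨h3, h4⟩ := flatMap_append_inj (fun k u u' hu => henc _ _ _ _ hu) _ _ _ hu
    exact ⟨List.flatMap_congr h3, h4⟩) _ _ _ h
  obtain ⟨h3, h4⟩ := encodeNat_append_inj h2
  refine ⟨?_, Fin.ext h3, ?_⟩
  · funext v z
    obtain ⟨k, hk, rfl⟩ := exists_bitStringOfNat z
    have h5 := h1 v (List.mem_finRange v)
    have h6 := (flatMap_append_inj (fun k u u' hu => henc _ _ _ _ hu) _ [] []
      (by simpa using h5)).1 k (List.mem_range.2 hk)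
    exact Fin.ext (encodeNat_append_inj (u := []) (v := []) (by simpa using h6)).1
  · have : Function.Injective TapeSym.bit := fun a b hab => by injection hab
    exact List.ofFn_injective (this.list_map h4)

/-- Every simulator is presented by some oracle. -/
theorem exists_isOracleFor {w d s : ℕ} (Sim : Automaton w d × Fin w → BitString s → Fin w) :
    ∃ f : List TapeSym → List Bool, IsOracleFor f Sim := by
  classical
  refine ⟨fun u => if h : ∃ p : Automaton w d × Fin w × BitString s,
      encodeInstance p.1 p.2.1 p.2.2 = u then
        (Sim (h.choose.1, h.choose.2.1) h.choose.2.2 : ℕ).bits else [], ?_⟩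
  intro Q q x
  have h : ∃ p : Automaton w d × Fin w × BitString s,
      encodeInstance p.1 p.2.1 p.2.2 = encodeInstance Q q x := ⟨(Q, q, x), rfl⟩
  obtain ⟨h1, h2, h3⟩ := encodeInstance_inj h.choose_spec
  simp only [dif_pos h]
  rw [h1, h2, h3]

/-!
Let `D` be the layered automaton on the states `(u, l)`, `u < w` and `l < m`, that runs `Q` and
counts the layer down. If it stops at layer `0`, then the probability to get from `(u, l)` to
`(t, 0)` in `m` steps is the probability `p l u t` that `Q` gets from `u` to `t` in `l` steps, and
so one simulator for `m` steps estimates all of these up to `ε`. If it goes on at layer `0`, then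
it gets from `(q, 0)` to `(t, 0)` with probability `p m q t`.

The generator uses the second automaton to draw a target `(t, 0)` from the simulator with its
seed, and then walks from `q`, always reading a block that maximizes the estimate for `p l u t` at
the next state `u`. Some block does not decrease the true probability, so a step loses at most
`2 * ε`, and the walk ends with an estimated probability above `0` if `p m q t` is above
`2 * m * ε`. With no step left, this forces the walk to end at `t`. So only targets that are rare
under `Q` are missed, and the distribution of the end of the walk is at most `2 * m * ε` below the
true one at every state.

For the space bound, all quantities that the generator handles (states of `D`, blocks, seeds,
counts of seeds, positions in the input) are natural numbers of size `poly(w, m, 2 ^ d, 2 ^ s)`,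
so it is enough to program it on a machine with finitely many counters, and to store every counter
in binary on a work tape of its own. The query to the oracle contains the transition table of `D`,
which is too long to be stored, but it can be written entry by entry from the input.
-/

/-! ### Distances and hitting probabilities -/

theorem uniformImage_toReal {n : ℕ} {α : Type*} [DecidableEq α] (g : BitString n → α) (a : α) :
    (uniformImage g a).toReal = (∑ x, if g x = a then (1 : ℝ) else 0) / 2 ^ n := by
  rw [uniformImage, PMF.map_apply, tsum_fintype, ENNReal.toReal_sum, Finset.sum_div]
  · refine Finset.sum_congr rfl fun x _ => ?_
    by_cases h : g x = a
    · simp [h]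
    · simp [h, Ne.symm h]
  · intro x _
    split_ifs
    exacts [PMF.apply_ne_top _ _, ENNReal.zero_ne_top]

section tvDist

variable {α : Type*} [Fintype α] (μ ν : PMF α)

theorem sum_toReal_sub_toReal : ∑ a, ((μ a).toReal - (ν a).toReal) = 0 := by
  have hsum : ∀ ξ : PMF α, ∑ a, (ξ a).toReal = 1 := fun ξ => by
    rw [← ENNReal.toReal_sum fun a _ => ξ.apply_ne_top a, ← tsum_fintype (L := .unconditional α),
      ξ.tsum_coe, ENNReal.toReal_one]
  rw [Finset.sum_sub_distrib, hsum, hsum, sub_self]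

theorem tvDist_nonneg : 0 ≤ tvDist μ ν := by
  unfold tvDist
  positivity

theorem abs_toReal_sub_le_tvDist (a : α) : |(μ a).toReal - (ν a).toReal| ≤ tvDist μ ν := by
  classical
  have hsum := sum_toReal_sub_toReal μ ν
  rw [← Finset.add_sum_erase _ _ (Finset.mem_univ a)] at hsum
  have hrest : |(μ a).toReal - (ν a).toReal| ≤
      ∑ b ∈ Finset.univ.erase a, |(μ b).toReal - (ν b).toReal| := by
    rw [eq_neg_of_add_eq_zero_left hsum, abs_neg]
    exact Finset.abs_sum_le_sum_abs _ _
  rw [tvDist, ← Finset.add_sum_erase _ _ (Finset.mem_univ a)]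
  linarith

variable {μ ν}

theorem tvDist_le_card_mul {δ : ℝ} (hδ : 0 ≤ δ) (h : ∀ a, (ν a).toReal ≤ (μ a).toReal + δ) :
    tvDist μ ν ≤ Fintype.card α * δ := by
  have habs : ∑ a, |(μ a).toReal - (ν a).toReal| ≤
      ∑ a, (((μ a).toReal - (ν a).toReal) + 2 * δ) :=
    Finset.sum_le_sum fun a _ => abs_le.2 ⟨by linarith [h a], by linarith⟩
  rw [Finset.sum_add_distrib, sum_toReal_sub_toReal, Finset.sum_const, Finset.card_univ,
    nsmul_eq_mul] at habs
  rw [tvDist]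
  linarith

end tvDist

theorem IsTargetedPRG.natCast_mul {ι : Type*} {n w s : ℕ} {ε : ℝ} {F : ι → BitString n → Fin w}
    {Gen : ι → BitString s → BitString n} (h : IsTargetedPRG ε F Gen) :
    IsTargetedPRG (w * ε) F Gen := by
  intro a
  have hw : (1 : ℝ) ≤ w := by exact_mod_cast (F a fun _ => false).pos
  exact (h a).trans (le_mul_of_one_le_left ((tvDist_nonneg _ _).trans (h a)) hw)

namespace Automaton

variable {w d : ℕ}

/-- The probability that the automaton `Q` reaches `t` from a given state in `n` steps, when it
reads uniformly distributed blocks. -/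
noncomputable def hitProb (Q : Automaton w d) (t : Fin w) : ℕ → Fin w → ℝ
  | 0, u => if u = t then 1 else 0
  | n + 1, u => (∑ z, hitProb Q t n (Q u z)) / 2 ^ d

theorem sum_foldl_eq_hitProb (Q : Automaton w d) (t : Fin w) (m : ℕ) (u : Fin w) :
    (∑ y : Fin m → BitString d, if Fin.foldl m (fun v i => Q v (y i)) u = t then (1 : ℝ) else 0) =
      2 ^ (m * d) * Q.hitProb t m u := by
  induction m generalizing u with
  | zero => simp [hitProb]
  | succ m ih =>
    rw [← (Fin.consEquiv fun _ : Fin (m + 1) => BitString d).sum_comp, Fintype.sum_prod_type]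
    simp only [Fin.foldl_succ, Fin.consEquiv_apply, Fin.cons_zero, Fin.cons_succ, hitProb, ih]
    rw [← Finset.mul_sum, add_mul, one_mul, pow_add]
    field_simp

theorem uniformImage_run_toReal (Q : Automaton w d) (t : Fin w) (m : ℕ) (u : Fin w) :
    (uniformImage (Q.run m u) t).toReal = Q.hitProb t m u := by
  rw [uniformImage_toReal, div_eq_iff (by positivity), mul_comm (Q.hitProb t m u),
    ← sum_foldl_eq_hitProb]
  exact Fintype.sum_equiv ((finProdFinEquiv.arrowCongr (Equiv.refl Bool)).symm.trans
    (Equiv.curry (Fin m) (Fin d) Bool)) _ _ fun _ => rfl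

theorem _root_.IsSimulator.abs_toReal_sub_hitProb_le {m s : ℕ} {ε : ℝ}
    {Sim : Automaton w d × Fin w → BitString s → Fin w}
    (h : IsSimulator ε (automatonClass w d m) Sim) (Q : Automaton w d) (u t : Fin w) :
    |(uniformImage (Sim (Q, u)) t).toReal - Q.hitProb t m u| ≤ ε := by
  rw [← uniformImage_run_toReal]
  exact (abs_toReal_sub_le_tvDist _ _ t).trans (h (Q, u))

/-! ### The layered automaton -/

/-- The automaton with `m` copies of each state of `Q`, where `(u, l)` is the copy of `u` in layer
`l`. Every step leads to the next lower layer. In layer `0`, the automaton keeps running as `Q` if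
`moving` is true, and stays where it is otherwise. Hence `m` steps from the layer `l` amount to `m`
steps of `Q` in the former case if `l = 0`, and to `l` steps of `Q` in the latter. -/
def layered {m : ℕ} (Q : Automaton w d) (moving : Bool) : Automaton (w * m) d := fun n z =>
  let (u, l) := finProdFinEquiv.symm n
  finProdFinEquiv (if (l : ℕ) = 0 ∧ moving = false then u else Q u z,
    ⟨l - 1, (Nat.sub_le _ _).trans_lt l.isLt⟩)

theorem layered_apply {m : ℕ} (Q : Automaton w d) (moving : Bool) (u : Fin w) (l : Fin m)
    (z : BitString d) : Q.layered moving (finProdFinEquiv (u, l)) z =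
      finProdFinEquiv (if (l : ℕ) = 0 ∧ moving = false then u else Q u z,
        ⟨l - 1, (Nat.sub_le _ _).trans_lt l.isLt⟩) := by
  simp [layered]

theorem hitProb_layered_frozen {m : ℕ} (hm : 0 < m) (Q : Automaton w d) (t : Fin w) {n l : ℕ}
    (hl : l < m) (hn : l ≤ n) (u : Fin w) :
    (Q.layered false).hitProb (finProdFinEquiv (t, ⟨0, hm⟩)) n (finProdFinEquiv (u, ⟨l, hl⟩)) =
      Q.hitProb t l u := by
  induction n generalizing l u with
  | zero =>
    obtain rfl : l = 0 := by omega
    simp [hitProb]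
  | succ n ih =>
    rcases l with _ | l
    · simp only [hitProb, layered_apply, and_self, if_true, Nat.zero_sub, ih hl (Nat.zero_le _)]
      rw [Finset.sum_const, Finset.card_univ, Fintype.card_pi_const, Fintype.card_bool,
        nsmul_eq_mul, Nat.cast_pow, Nat.cast_ofNat, mul_div_cancel_left₀ _ (by positivity)]
    · simp [hitProb, layered_apply, ih (Nat.lt_of_succ_lt hl) (Nat.le_of_succ_le_succ hn)]

theorem hitProb_layered_moving {m : ℕ} (hm : 0 < m) (Q : Automaton w d) (t : Fin w) (n : ℕ)
    (u : Fin w) :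
    (Q.layered true).hitProb (finProdFinEquiv (t, ⟨0, hm⟩)) n (finProdFinEquiv (u, ⟨0, hm⟩)) =
      Q.hitProb t n u := by
  induction n generalizing u with
  | zero => simp [hitProb]
  | succ n ih => simp [hitProb, layered_apply, ih]

end Automaton

/-! ### Greedy paths -/

/-- The least `z < n` at which `c` is maximal (and `0` if there is no `z < n`). -/
def argmaxBelow (c : ℕ → ℕ) : ℕ → ℕ
  | 0 => 0
  | n + 1 => if c (argmaxBelow c n) < c n then n else argmaxBelow c n

theorem argmaxBelow_lt (c : ℕ → ℕ) {n : ℕ} (hn : 0 < n) : argmaxBelow c n < n := by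
  induction n with
  | zero => exact absurd hn (lt_irrefl 0)
  | succ n ih =>
    rw [argmaxBelow]
    rcases Nat.eq_zero_or_pos n with rfl | hpos
    · simp [argmaxBelow]
    · split_ifs <;> grind

theorem le_argmaxBelow (c : ℕ → ℕ) {n j : ℕ} (hj : j < n) : c j ≤ c (argmaxBelow c n) := by
  induction n with
  | zero => exact absurd hj (Nat.not_lt_zero j)
  | succ n ih =>
    rw [argmaxBelow]
    split_ifs <;> grind

namespace Automaton

variable {w d : ℕ} (Q : Automaton w d) (score : ℕ → Fin w → ℕ)

/-- The number of a block that leads from `u` to a state with a maximal score in the layer `l`. -/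
def greedyBlock (l : ℕ) (u : Fin w) : ℕ :=
  argmaxBelow (fun z => score l (Q u (bitStringOfNat d z))) (2 ^ d)

theorem greedyBlock_lt (l : ℕ) (u : Fin w) : Q.greedyBlock score l u < 2 ^ d :=
  argmaxBelow_lt _ (Nat.two_pow_pos d)

theorem score_le_score_greedyBlock (l : ℕ) (u : Fin w) (z : BitString d) :
    score l (Q u z) ≤ score l (Q u (bitStringOfNat d (Q.greedyBlock score l u))) := by
  obtain ⟨k, hk, rfl⟩ := exists_bitStringOfNat z
  exact le_argmaxBelow (fun z => score l (Q u (bitStringOfNat d z))) hk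

/-- The blocks on a path of length `n` from a given state that greedily maximizes the score of the
next state, where the layer of a state is the number of steps that are left. -/
def greedyBlocks : (n : ℕ) → Fin w → Fin n → BitString d
  | 0, _ => Fin.elim0
  | l + 1, u => Fin.cons (bitStringOfNat d (Q.greedyBlock score l u))
      (greedyBlocks l (Q u (bitStringOfNat d (Q.greedyBlock score l u))))

variable {Q score} {t : Fin w} {K ε : ℝ} {m : ℕ}

theorem hitProb_succ_le_greedyBlock (hK : 0 ≤ K) {l : ℕ}
    (hscore : ∀ u, |score l u / K - Q.hitProb t l u| ≤ ε) (u : Fin w) :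
    Q.hitProb t (l + 1) u ≤
      Q.hitProb t l (Q u (bitStringOfNat d (Q.greedyBlock score l u))) + 2 * ε := by
  set v := Q u (bitStringOfNat d (Q.greedyBlock score l u))
  have hmax : ∀ z, Q.hitProb t l (Q u z) ≤ Q.hitProb t l v + 2 * ε := by
    intro z
    have hle : (score l (Q u z) : ℝ) / K ≤ score l v / K :=
      div_le_div_of_nonneg_right (by exact_mod_cast score_le_score_greedyBlock Q score l u z) hK
    linarith [(abs_le.1 (hscore (Q u z))).1, (abs_le.1 (hscore v)).2]
  rw [hitProb, div_le_iff₀ (by positivity)]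
  refine (Finset.sum_le_card_nsmul _ _ _ fun z _ => hmax z).trans_eq ?_
  simp only [Finset.card_univ, Fintype.card_pi, Fintype.card_bool, Finset.prod_const,
    Fintype.card_fin, nsmul_eq_mul, Nat.cast_pow, Nat.cast_ofNat]
  ring

theorem hitProb_le_foldl_greedyBlocks (hK : 0 ≤ K)
    (hscore : ∀ l < m, ∀ u, |score l u / K - Q.hitProb t l u| ≤ ε) {n : ℕ} (hn : n ≤ m)
    (u : Fin w) :
    Q.hitProb t n u ≤
      Q.hitProb t 0 (Fin.foldl n (fun v i => Q v (Q.greedyBlocks score n u i)) u) +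
        2 * n * ε := by
  induction n generalizing u with
  | zero => simp
  | succ l ih =>
    have hstep := hitProb_succ_le_greedyBlock hK (hscore l hn) u
    have hrest := ih (Nat.le_of_succ_le hn) (Q u (bitStringOfNat d (Q.greedyBlock score l u)))
    simp only [Fin.foldl_succ, greedyBlocks, Fin.cons_zero, Fin.cons_succ]
    push_cast
    linarith

theorem foldl_greedyBlocks_eq (hK : 0 ≤ K)
    (hscore : ∀ l < m, ∀ u, |score l u / K - Q.hitProb t l u| ≤ ε) {u : Fin w}
    (hu : 2 * m * ε < Q.hitProb t m u) :
    Fin.foldl m (fun v i => Q v (Q.greedyBlocks score m u i)) u = t := by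
  have hle := hitProb_le_foldl_greedyBlocks hK hscore le_rfl u
  by_contra hne
  rw [hitProb, if_neg hne] at hle
  linarith

end Automaton

/-! ### The generator as a function -/

theorem bitStringOfNat_ofBits {d : ℕ} (z : BitString d) : bitStringOfNat d (Nat.ofBits z) = z := by
  funext j
  simp [bitStringOfNat]

theorem bitStringOfNat_injOn (s : ℕ) : Set.InjOn (bitStringOfNat s) {k | k < 2 ^ s} := by
  intro k hk k' hk' h
  refine Nat.eq_of_testBit_eq fun i => ?_
  rcases lt_or_ge i s with hi | hi
  · exact congrFun h ⟨i, hi⟩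
  · have hpow : 2 ^ s ≤ 2 ^ i := Nat.pow_le_pow_right two_pos hi
    rw [Nat.testBit_lt_two_pow (hk.trans_le hpow), Nat.testBit_lt_two_pow (hk'.trans_le hpow)]

theorem count_bitStringOfNat_div {s : ℕ} {α : Type*} [DecidableEq α] (g : BitString s → α) (a : α) :
    (Nat.count (fun y => g (bitStringOfNat s y) = a) (2 ^ s) : ℝ) / 2 ^ s =
      (uniformImage g a).toReal := by
  rw [uniformImage_toReal, Finset.sum_boole, Nat.count_eq_card_filter_range]
  congr 2
  refine Finset.card_bij (fun y _ => bitStringOfNat s y) (by simp) ?_ fun x hx =>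
    ⟨Nat.ofBits x, by simpa [Nat.ofBits_lt_two_pow, bitStringOfNat_ofBits] using hx,
      bitStringOfNat_ofBits x⟩
  intro y hy y' hy' h
  simp only [Finset.mem_filter, Finset.mem_range] at hy hy'
  exact bitStringOfNat_injOn s hy.1 hy'.1 h

section Greedy

variable {w d m s : ℕ} (Sim : Automaton (w * m) d × Fin (w * m) → BitString s → Fin (w * m))
  (Q : Automaton w d)

/-- The number of seeds with which the simulator moves from the state `u` in the layer `l` of the
layered automaton to `V`. Up to a factor `2 ^ s`, this is an estimate for the probability to get
from `u` to the state with the copy `V` in layer `0` in `l` steps. -/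
def hitCount (V : Fin (w * m)) (l : ℕ) (u : Fin w) : ℕ :=
  Nat.count (fun y => ∃ h : l < m,
    Sim (Q.layered false, finProdFinEquiv (u, ⟨l, h⟩)) (bitStringOfNat s y) = V) (2 ^ s)

/-- The targeted generator: simulate `m` steps of `Q`, and follow a greedy path to the state that
has been reached. -/
def greedyGen (a : Automaton w d × Fin w) (x : BitString s) : BitString (m * d) := fun p =>
  let l₀ : Fin m := ⟨0, (finProdFinEquiv.symm p).1.pos⟩
  let V := Sim (a.1.layered true, finProdFinEquiv (a.2, l₀)) x
  a.1.greedyBlocks (hitCount Sim a.1 V) m a.2 (finProdFinEquiv.symm p).1 (finProdFinEquiv.symm p).2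

variable {Sim} {ε : ℝ} (hm : 0 < m) (hSim : IsSimulator ε (automatonClass (w * m) d m) Sim)
include hm

theorem run_greedyGen (q : Fin w) (x : BitString s) : Q.run m q (greedyGen Sim (Q, q) x) =
    Fin.foldl m (fun v i => Q v (Q.greedyBlocks
      (hitCount Sim Q (Sim (Q.layered true, finProdFinEquiv (q, ⟨0, hm⟩)) x)) m q i)) q := by
  simp [Automaton.run, greedyGen]

include hSim

theorem abs_hitCount_sub_hitProb_le (t : Fin w) {l : ℕ} (hl : l < m) (u : Fin w) :
    |hitCount Sim Q (finProdFinEquiv (t, ⟨0, hm⟩)) l u / 2 ^ s - Q.hitProb t l u| ≤ ε := by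
  simp only [hitCount, hl, exists_true_left]
  rw [count_bitStringOfNat_div (Sim (Q.layered false, finProdFinEquiv (u, ⟨l, hl⟩))),
    ← Q.hitProb_layered_frozen hm t hl hl.le]
  exact hSim.abs_toReal_sub_hitProb_le ..

theorem hitProb_sub_le_toReal_greedyGen (q t : Fin w) (ht : 2 * m * ε < Q.hitProb t m q) :
    Q.hitProb t m q - ε ≤
      (uniformImage (fun x => Q.run m q (greedyGen Sim (Q, q) x)) t).toReal := by
  have hsim := hSim.abs_toReal_sub_hitProb_le (Q.layered true) (finProdFinEquiv (q, ⟨0, hm⟩))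
    (finProdFinEquiv (t, ⟨0, hm⟩))
  rw [Q.hitProb_layered_moving] at hsim
  have hreach : ∀ x, Sim (Q.layered true, finProdFinEquiv (q, ⟨0, hm⟩)) x =
      finProdFinEquiv (t, ⟨0, hm⟩) → Q.run m q (greedyGen Sim (Q, q) x) = t := fun x hx => by
    rw [run_greedyGen Q hm, hx]
    exact Automaton.foldl_greedyBlocks_eq (by positivity)
      (fun l hl => abs_hitCount_sub_hitProb_le Q hm hSim t hl) ht
  refine le_trans (by linarith [(abs_le.1 hsim).1]) (b := (uniformImage _ _).toReal) ?_
  rw [uniformImage_toReal, uniformImage_toReal]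
  gcongr with x
  grind

theorem isTargetedPRG_greedyGen :
    IsTargetedPRG (2 * m * w * ε) (automatonClass w d m) (greedyGen Sim) := by
  rintro ⟨Q, q⟩
  have hε : 0 ≤ ε := (tvDist_nonneg _ _).trans
    (hSim (Q.layered true, finProdFinEquiv (q, ⟨0, hm⟩)))
  have hεm : ε ≤ 2 * m * ε := by
    have hm' : (1 : ℝ) ≤ m := by exact_mod_cast hm
    exact le_mul_of_one_le_left hε (by linarith)
  have hδ : 0 ≤ 2 * m * ε := by positivity
  refine (tvDist_le_card_mul hδ fun t => ?_).trans_eq (by rw [Fintype.card_fin]; ring)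
  refine (Q.uniformImage_run_toReal t m q).trans_le ?_
  rcases le_or_gt (Q.hitProb t m q) (2 * m * ε) with hrare | hlikely
  · exact hrare.trans (le_add_of_nonneg_left ENNReal.toReal_nonneg)
  · have hhit := hitProb_sub_le_toReal_greedyGen Q hm hSim q t hlikely
    exact (sub_le_iff_le_add.1 hhit).trans (add_le_add_right hεm _)

end Greedy

/-! ### Programs with counters -/

/-- The surroundings of a computation with counters: the oracle, the input, and a bound on the
values of the counters. -/
structure RunEnv : Type where
  oracle : List TapeSym → List Bool
  input : List TapeSym
  bound : ℕ

/-- The memory of a computation with counters in `R`. -/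
@[ext]
structure CounterState (R : Type) : Type where
  reg : R → ℕ
  inputHead : ℕ
  oracleTape : List TapeSym
  output : List Bool

namespace CounterState

variable {R : Type} (σ : CounterState R)

/-- The state at the beginning of a computation. -/
def zero : CounterState R := ⟨fun _ => 0, 0, [], []⟩

open Classical in
/-- Assignment to a counter. -/
noncomputable def set (r : R) (n : ℕ) : CounterState R :=
  { σ with reg := Function.update σ.reg r n }

/-- Writing on the output tape and on the oracle tape. -/
def write (out : Option Bool) (orc : Option TapeSym) : CounterState R :=
  { σ with oracleTape := σ.oracleTape ++ orc.toList, output := σ.output ++ out.toList }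

/-- The values `σ.reg`, moved along `ρ` to counters in `T`; the other counters in `T` have the
values `base`. -/
noncomputable def extend {T : Type} (ρ : R → T) (base : T → ℕ) : CounterState T :=
  { σ with reg := Function.extend ρ σ.reg base }

/-- The state with one more counter, `none`, of value `n`. -/
def push (n : ℕ) : CounterState (Option R) :=
  { σ with reg := fun r => r.elim n σ.reg }

theorem set_extend {T : Type} {ρ : R → T} (hρ : ρ.Injective) (base : T → ℕ) (r : R) (n : ℕ) :
    (σ.extend ρ base).set (ρ r) n = (σ.set r n).extend ρ base := by
  ext t
  · by_cases ht : ∃ a, ρ a = t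
    · obtain ⟨a, rfl⟩ := ht
      by_cases ha : a = r <;> simp [set, extend, hρ.extend_apply, ha, hρ.eq_iff]
    · have hne : t ≠ ρ r := fun h => ht ⟨r, h.symm⟩
      simp [set, extend, Function.extend_apply' _ _ _ ht, hne]
  all_goals rfl

theorem extend_push {T : Type} {ρ : Option R → T} (hρ : ρ.Injective) {base : T → ℕ}
    (h : base (ρ none) = 0) :
    (σ.push 0).extend ρ base = σ.extend (fun r => ρ (some r)) base := by
  have hsome : (fun r => ρ (some r)).Injective := hρ.comp (Option.some_injective R)
  ext t
  · by_cases ht : ∃ a, ρ (some a) = t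
    · obtain ⟨a, rfl⟩ := ht
      simpa [extend, hρ.extend_apply, push] using (hsome.extend_apply σ.reg base a).symm
    · simp only [extend, Function.extend_apply' _ _ _ ht]
      by_cases hn : ρ none = t
      · subst hn
        simp [hρ.extend_apply, push, h]
      · refine Function.extend_apply' _ _ _ ?_
        rintro ⟨_ | a, ha⟩
        exacts [hn ha, ht ⟨a, ha⟩]
  all_goals rfl

end CounterState

/-- An elementary operation on counters in `R` and on the external tapes. -/
inductive CounterOp (R : Type) : Type
  | inc (r : R)
  | move (dir : HeadMove)
  | write (out : Option Bool) (orc : Option TapeSym)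

/-- A test, possibly with a side effect: `pos r` also decrements `r`, and `answer p` submits the
oracle tape. -/
inductive CounterTest (R : Type) : Type
  | pos (r : R)
  | look (p : InputSym → Bool)
  | answer (p : Option Bool → Bool)

namespace CounterOp

variable {R : Type}

/-- The side condition of an operation: counters stay within the bound, and the input head does
not cross the right end marker. -/
def Legal (E : RunEnv) (σ : CounterState R) : CounterOp R → Prop
  | inc r => σ.reg r < E.bound
  | move dir => LLMachine.moveHead dir σ.inputHead ≤ E.input.length + 1
  | write _ _ => True

/-- The effect of an operation. -/
noncomputable def apply (σ : CounterState R) : CounterOp R → CounterState R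
  | inc r => σ.set r (σ.reg r + 1)
  | move dir => { σ with inputHead := LLMachine.moveHead dir σ.inputHead }
  | write out orc => σ.write out orc

/-- Renaming of counters. -/
def map {T : Type} (ρ : R → T) : CounterOp R → CounterOp T
  | inc r => inc (ρ r)
  | move dir => move dir
  | write out orc => write out orc

theorem legal_map {T : Type} {ρ : R → T} (hρ : ρ.Injective) {base : T → ℕ} {E : RunEnv}
    {σ : CounterState R} {a : CounterOp R} (h : a.Legal E σ) :
    (a.map ρ).Legal E (σ.extend ρ base) := by
  cases a with
  | inc r => simpa [map, Legal, CounterState.extend, hρ.extend_apply] using h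
  | _ => exact h

theorem apply_map {T : Type} {ρ : R → T} (hρ : ρ.Injective) (base : T → ℕ) (σ : CounterState R)
    (a : CounterOp R) : (a.map ρ).apply (σ.extend ρ base) = (a.apply σ).extend ρ base := by
  cases a with
  | inc r =>
    have hr : (σ.extend ρ base).reg (ρ r) = σ.reg r := hρ.extend_apply _ _ _
    simp only [map, apply, hr, σ.set_extend hρ]
  | _ => rfl

end CounterOp

namespace CounterTest

variable {R : Type}

/-- The outcome of a test. -/
def holds (E : RunEnv) (σ : CounterState R) : CounterTest R → Bool
  | pos r => 0 < σ.reg r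
  | look p => p (LLMachine.scan E.input σ.inputHead)
  | answer p => p (oracleAnswer E.oracle σ.oracleTape)

/-- The side effect of a test; decrementing has no effect on a counter that is zero. -/
noncomputable def after (σ : CounterState R) : CounterTest R → CounterState R
  | pos r => σ.set r (σ.reg r - 1)
  | look _ => σ
  | answer _ => { σ with oracleTape := [] }

/-- Renaming of counters. -/
def map {T : Type} (ρ : R → T) : CounterTest R → CounterTest T
  | pos r => pos (ρ r)
  | look p => look p
  | answer p => answer p

theorem holds_map {T : Type} {ρ : R → T} (hρ : ρ.Injective) (base : T → ℕ) (E : RunEnv)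
    (σ : CounterState R) (t : CounterTest R) :
    (t.map ρ).holds E (σ.extend ρ base) = t.holds E σ := by
  cases t with
  | pos r => simp [map, holds, CounterState.extend, hρ.extend_apply]
  | _ => rfl

theorem after_map {T : Type} {ρ : R → T} (hρ : ρ.Injective) (base : T → ℕ) (σ : CounterState R)
    (t : CounterTest R) : (t.map ρ).after (σ.extend ρ base) = (t.after σ).extend ρ base := by
  cases t with
  | pos r =>
    have hr : (σ.extend ρ base).reg (ρ r) = σ.reg r := hρ.extend_apply _ _ _
    simp only [map, after, hr, σ.set_extend hρ]
  | _ => rfl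

end CounterTest

/-- Structured programs with counters in `R`. The program `new A` runs `A` with a fresh counter
`none`, which is zero at the beginning and has to be zero again at the end. -/
inductive CounterProg : Type → Type 1
  | op {R : Type} (a : CounterOp R) : CounterProg R
  | seq {R : Type} (A B : CounterProg R) : CounterProg R
  | branch {R : Type} (t : CounterTest R) (A B : CounterProg R) : CounterProg R
  | loop {R : Type} (t : CounterTest R) (A : CounterProg R) : CounterProg R
  | new {R : Type} (A : CounterProg (Option R)) : CounterProg R

namespace CounterProg

/-- `P.Runs E σ σ'` means that `P`, started in the state `σ`, terminates in the state `σ'`, and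
that all operations on the way are legal. -/
inductive Runs (E : RunEnv) :
    ∀ {R : Type}, CounterProg R → CounterState R → CounterState R → Prop
  | op {R : Type} {a : CounterOp R} {σ : CounterState R} (h : a.Legal E σ) :
    Runs E (op a) σ (a.apply σ)
  | seq {R : Type} {A B : CounterProg R} {σ τ υ : CounterState R} (hA : Runs E A σ τ)
    (hB : Runs E B τ υ) : Runs E (seq A B) σ υ
  | branch_true {R : Type} {t : CounterTest R} {A B : CounterProg R} {σ τ : CounterState R}
    (h : t.holds E σ = true) (hA : Runs E A (t.after σ) τ) : Runs E (branch t A B) σ τ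
  | branch_false {R : Type} {t : CounterTest R} {A B : CounterProg R} {σ τ : CounterState R}
    (h : t.holds E σ = false) (hB : Runs E B (t.after σ) τ) : Runs E (branch t A B) σ τ
  | loop_done {R : Type} {t : CounterTest R} {A : CounterProg R} {σ : CounterState R}
    (h : t.holds E σ = false) : Runs E (loop t A) σ (t.after σ)
  | loop_step {R : Type} {t : CounterTest R} {A : CounterProg R} {σ τ υ : CounterState R}
    (h : t.holds E σ = true) (hA : Runs E A (t.after σ) τ) (hB : Runs E (loop t A) τ υ) :
    Runs E (loop t A) σ υ
  | new {R : Type} {A : CounterProg (Option R)} {σ τ : CounterState R}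
    (hA : Runs E A (σ.push 0) (τ.push 0)) : Runs E (new A) σ τ

end CounterProg

/-! ### Flow charts -/

/-- A node of a flow chart with counters in `T` and nodes in `L`. -/
inductive CounterInstr (T L : Type) : Type
  | halt
  | op (a : CounterOp T) (next : L)
  | test (t : CounterTest T) (yes no : L)

/-- One step of the flow chart `code`. -/
inductive FlowStep {T L : Type} (E : RunEnv) (code : L → CounterInstr T L) :
    L × CounterState T → L × CounterState T → Prop
  | op {l n : L} {σ : CounterState T} {a : CounterOp T} (hl : code l = .op a n)
    (h : a.Legal E σ) : FlowStep E code (l, σ) (n, a.apply σ)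
  | test {l y n : L} {σ : CounterState T} {t : CounterTest T} (hl : code l = .test t y n) :
    FlowStep E code (l, σ) (bif t.holds E σ then y else n, t.after σ)

theorem FlowStep.op_map {R T L : Type} {E : RunEnv} {code : L → CounterInstr T L} {ρ : R → T}
    (hρ : ρ.Injective) {base : T → ℕ} {σ : CounterState R} {a : CounterOp R} {l n : L}
    (hl : code l = .op (a.map ρ) n) (h : a.Legal E σ) :
    FlowStep E code (l, σ.extend ρ base) (n, (a.apply σ).extend ρ base) := by
  rw [← CounterOp.apply_map hρ]
  exact .op hl (CounterOp.legal_map hρ h)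

theorem FlowStep.test_map {R T L : Type} {E : RunEnv} {code : L → CounterInstr T L} {ρ : R → T}
    (hρ : ρ.Injective) (base : T → ℕ) (σ : CounterState R) {t : CounterTest R} {l y n : L}
    (hl : code l = .test (t.map ρ) y n) :
    FlowStep E code (l, σ.extend ρ base)
      (bif t.holds E σ then y else n, (t.after σ).extend ρ base) := by
  rw [← CounterTest.after_map hρ, ← CounterTest.holds_map hρ base]
  exact .test hl

namespace CounterProg

/-- The nodes of the flow chart of a program. -/
def Label : {R : Type} → CounterProg R → Type
  | _, op _ => Unit
  | _, seq A B => Label A ⊕ Label B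
  | _, branch _ A B => Option (Label A ⊕ Label B)
  | _, loop _ A => Option (Label A)
  | _, new A => Label A

/-- The counters that a program creates. -/
def Local : {R : Type} → CounterProg R → Type
  | _, op _ => Empty
  | _, seq A B => Local A ⊕ Local B
  | _, branch _ A B => Local A ⊕ Local B
  | _, loop _ A => Local A
  | _, new A => Option (Local A)

/-- The first node of the flow chart of a program. -/
def entry : {R : Type} → (P : CounterProg R) → P.Label
  | _, op _ => ()
  | _, seq A _ => Sum.inl A.entry
  | _, branch _ _ _ => (none : Option _)
  | _, loop _ _ => (none : Option _)
  | _, new A => A.entry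

/-- The flow chart of a program as a part of a flow chart with counters in `T` and nodes in `L`:
`ρ`, `loc` and `node` embed the counters, the created counters and the nodes, and `exit` is the
node reached at the end. -/
def instr {T L : Type} : {R : Type} → (P : CounterProg R) → (ρ : R → T) → (loc : P.Local → T) →
    (node : P.Label → L) → (exit : L) → P.Label → CounterInstr T L
  | _, op a, ρ, _, _, exit => fun _ => .op (a.map ρ) exit
  | _, seq A B, ρ, loc, node, exit => Sum.elim
      (A.instr ρ (fun t => loc (Sum.inl t)) (fun l => node (Sum.inl l)) (node (Sum.inr B.entry)))
      (B.instr ρ (fun t => loc (Sum.inr t)) (fun l => node (Sum.inr l)) exit)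
  | _, branch t A B, ρ, loc, node, exit => fun l => Option.elim l
      (.test (t.map ρ) (node (some (Sum.inl A.entry))) (node (some (Sum.inr B.entry))))
      (Sum.elim
        (A.instr ρ (fun t => loc (Sum.inl t)) (fun l => node (some (Sum.inl l))) exit)
        (B.instr ρ (fun t => loc (Sum.inr t)) (fun l => node (some (Sum.inr l))) exit))
  | _, loop t A, ρ, loc, node, exit => fun l => Option.elim l
      (.test (t.map ρ) (node (some A.entry)) exit)
      (A.instr ρ loc (fun l => node (some l)) (node none))
  | _, new A, ρ, loc, node, exit =>
      A.instr (fun r => r.elim (loc none) ρ) (fun t => loc (some t)) node exit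

theorem finite_label : {R : Type} → (P : CounterProg R) → Finite P.Label
  | _, op _ => inferInstanceAs (Finite Unit)
  | _, seq A B => by
    have := A.finite_label
    have := B.finite_label
    exact inferInstanceAs (Finite (A.Label ⊕ B.Label))
  | _, branch _ A B => by
    have := A.finite_label
    have := B.finite_label
    exact inferInstanceAs (Finite (Option (A.Label ⊕ B.Label)))
  | _, loop _ A => by
    have := A.finite_label
    exact inferInstanceAs (Finite (Option A.Label))
  | _, new A => A.finite_label

theorem finite_local : {R : Type} → (P : CounterProg R) → Finite P.Local
  | _, op _ => inferInstanceAs (Finite Empty)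
  | _, seq A B => by
    have := A.finite_local
    have := B.finite_local
    exact inferInstanceAs (Finite (A.Local ⊕ B.Local))
  | _, branch _ A B => by
    have := A.finite_local
    have := B.finite_local
    exact inferInstanceAs (Finite (A.Local ⊕ B.Local))
  | _, loop _ A => A.finite_local
  | _, new A => by
    have := A.finite_local
    exact inferInstanceAs (Finite (Option A.Local))

/-- The counters `ρ` in scope and the counters `loc` still to be created are distinct counters
in `T`, and the latter are zero. -/
structure IsLayout {R K T : Type} (ρ : R → T) (loc : K → T) (base : T → ℕ) : Prop where
  injective : ρ.Injective
  injective_loc : loc.Injective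
  ne (r : R) (k : K) : ρ r ≠ loc k
  base_loc (k : K) : base (loc k) = 0

theorem IsLayout.comp {R K K' T : Type} {ρ : R → T} {loc : K → T} {base : T → ℕ}
    (h : IsLayout ρ loc base) {f : K' → K} (hf : f.Injective) :
    IsLayout ρ (fun k => loc (f k)) base :=
  ⟨h.injective, h.injective_loc.comp hf, fun r k => h.ne r (f k), fun k => h.base_loc (f k)⟩

theorem IsLayout.new {R K T : Type} {ρ : R → T} {loc : Option K → T} {base : T → ℕ}
    (h : IsLayout ρ loc base) :
    IsLayout (fun r : Option R => r.elim (loc none) ρ) (fun k => loc (some k)) base where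
  injective := by
    rintro (_ | a) (_ | b) hab
    exacts [rfl, (h.ne _ _ hab.symm).elim, (h.ne _ _ hab).elim, congrArg _ (h.injective hab)]
  injective_loc := h.injective_loc.comp (Option.some_injective K)
  ne
    | none, k => fun hk => Option.some_ne_none k (h.injective_loc hk.symm)
    | some r, k => h.ne r (some k)
  base_loc k := h.base_loc (some k)

theorem Runs.reaches_exit {E : RunEnv} {R : Type} {P : CounterProg R} {σ σ' : CounterState R}
    (h : P.Runs E σ σ') {T L : Type} {code : L → CounterInstr T L} {ρ : R → T}
    {loc : P.Local → T} {node : P.Label → L} {exit : L} {base : T → ℕ}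
    (hloc : IsLayout ρ loc base) (hcode : ∀ l, code (node l) = P.instr ρ loc node exit l) :
    Relation.ReflTransGen (FlowStep E code) (node P.entry, σ.extend ρ base)
      (exit, σ'.extend ρ base) := by
  induction h generalizing exit with
  | op h =>
    exact .single (.op_map hloc.injective (hcode ()) h)
  | seq _ _ ihA ihB =>
    exact (ihA (hloc.comp Sum.inl_injective) fun l => hcode (Sum.inl l)).trans
      (ihB (hloc.comp Sum.inr_injective) fun l => hcode (Sum.inr l))
  | @branch_true _ _ _ _ σ _ h _ ihA =>
    have hstep := FlowStep.test_map (E := E) hloc.injective base σ (hcode none)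
    rw [h] at hstep
    exact .head hstep (ihA (hloc.comp Sum.inl_injective) fun l => hcode (some (Sum.inl l)))
  | @branch_false _ _ _ _ σ _ h _ ihB =>
    have hstep := FlowStep.test_map (E := E) hloc.injective base σ (hcode none)
    rw [h] at hstep
    exact .head hstep (ihB (hloc.comp Sum.inr_injective) fun l => hcode (some (Sum.inr l)))
  | @loop_done _ _ _ σ h =>
    have hstep := FlowStep.test_map (E := E) hloc.injective base σ (hcode none)
    rw [h] at hstep
    exact .single hstep
  | @loop_step _ _ _ σ _ _ h _ _ ihA ihB =>
    have hstep := FlowStep.test_map (E := E) hloc.injective base σ (hcode none)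
    rw [h] at hstep
    exact .head hstep ((ihA hloc fun l => hcode (some l)).trans (ihB hloc hcode))
  | new _ ih =>
    have hpush := fun υ : CounterState _ =>
      υ.extend_push (base := base) hloc.new.injective (hloc.base_loc none)
    have hrun := ih hloc.new hcode
    rwa [hpush, hpush] at hrun

end CounterProg

/-! ### Binary counters on work tapes -/

/-- The number with binary digits `l`, least significant first. -/
def binVal (l : List Bool) : ℕ := Nat.ofDigits 2 (l.map Bool.toNat)

theorem binVal_cons (b : Bool) (l : List Bool) : binVal (b :: l) = b.toNat + 2 * binVal l := by
  simp [binVal, Nat.ofDigits_cons]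

theorem binVal_append (l l' : List Bool) :
    binVal (l ++ l') = binVal l + 2 ^ l.length * binVal l' := by
  simp [binVal, Nat.ofDigits_append]

theorem binVal_replicate_false (k : ℕ) : binVal (List.replicate k false) = 0 := by
  simp [binVal]

theorem binVal_replicate_true (k : ℕ) : binVal (List.replicate k true) + 1 = 2 ^ k := by
  induction k with
  | zero => rfl
  | succ k ih =>
    rw [List.replicate_succ, binVal_cons, Bool.toNat_true, pow_succ, ← ih]
    ring

theorem binVal_carry (k : ℕ) (l : List Bool) :
    binVal (List.replicate k true ++ false :: l) + 1 =
      binVal (List.replicate k false ++ true :: l) := by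
  simp only [binVal_append, binVal_replicate_false, binVal_cons, List.length_replicate,
    Bool.toNat_true, Bool.toNat_false, ← binVal_replicate_true k]
  ring

theorem eq_replicate_append_not_cons_or (b : Bool) (l : List Bool) :
    (∃ k l', l = List.replicate k b ++ (!b) :: l') ∨ ∃ k, l = List.replicate k b := by
  induction l with
  | nil => exact .inr ⟨0, rfl⟩
  | cons a l ih =>
    by_cases ha : a = b
    · subst ha
      rcases ih with ⟨k, l', rfl⟩ | ⟨k, rfl⟩
      exacts [.inl ⟨k + 1, l', rfl⟩, .inr ⟨k + 1, rfl⟩]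
    · exact .inl ⟨0, l, by simpa using Bool.eq_not_of_ne ha⟩

/-- The work alphabet: a marker for the left end of a tape, a blank, and the two bits. -/
inductive WorkSym : Type
  | mark
  | blank
  | bit (b : Bool)

instance : Finite WorkSym := by
  refine Finite.of_injective (β := Option (Option Bool)) (fun a => match a with
    | .mark => none
    | .blank => some none
    | .bit b => some (some b)) ?_
  rintro (_ | _ | _) (_ | _ | _) h <;> simp_all

/-- The contents of a work tape that holds the binary digits `l`. -/
def workTape (l : List Bool) : ℕ → WorkSym
  | 0 => .mark
  | p + 1 => l[p]?.elim .blank .bit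

theorem workTape_append_cons (l l' : List Bool) (b : Bool) :
    workTape (l ++ b :: l') (l.length + 1) = .bit b := by
  simp [workTape]

theorem workTape_length_succ (l : List Bool) : workTape l (l.length + 1) = .blank := by
  simp [workTape]

theorem update_workTape (l l' : List Bool) (a b : Bool) :
    Function.update (workTape (l ++ a :: l')) (l.length + 1) (.bit b) =
      workTape (l ++ b :: l') := by
  have hset : l ++ b :: l' = (l ++ a :: l').set l.length b := by simp
  funext p
  rcases p with _ | p
  · simp [workTape]
  · by_cases hp : p = l.length
    · simp [hp, workTape]
    · have hget : (l ++ b :: l')[p]? = (l ++ a :: l')[p]? := by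
        rw [hset, List.getElem?_set_ne (Ne.symm hp)]
      simp [workTape, hp, hget]

theorem update_workTape_concat (l : List Bool) (b : Bool) :
    Function.update (workTape l) (l.length + 1) (.bit b) = workTape (l ++ [b]) := by
  funext p
  rcases p with _ | p
  · simp [workTape]
  · rcases lt_trichotomy p l.length with hp | rfl | hp
    · simp [workTape, hp.ne, List.getElem?_append_left hp]
    · simp [workTape]
    · have hnone : (l ++ [b])[p]? = none := List.getElem?_eq_none (by simpa using hp)
      simp [workTape, hp.ne', hnone, hp.le]

/-- The control states of the machine of a flow chart: `carry r b yes no` moves right on the tape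
`r` and flips the digits `b` up to the first other digit, which is flipped as well; and
`rewind r undo l` moves back to the left end, clearing the digits on the way if `undo` is true. -/
inductive CounterCtl (T L : Type) : Type
  | init
  | run (l : L)
  | carry (r : T) (b : Bool) (yes no : L)
  | rewind (r : T) (undo : Bool) (l : L)

instance {T L : Type} [Finite T] [Finite L] : Finite (CounterCtl T L) := by
  refine Finite.of_injective
    (β := Option (L ⊕ (T × Bool × L × L) ⊕ (T × Bool × L))) (fun a => match a with
    | .init => none
    | .run l => some (.inl l)
    | .carry r b yes no => some (.inr (.inl (r, b, yes, no)))
    | .rewind r undo l => some (.inr (.inr (r, undo, l)))) ?_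
  rintro (_ | _ | _ | _) (_ | _ | _ | _) h <;> simp_all

section Machine

variable {T L : Type}

/-- An action that does not change the work tapes, where `g` are the scanned work symbols. -/
def leaveWork {Q : Type} (next : Q) (dir : HeadMove) (out : Option Bool) (orc : Option TapeSym)
    (g : T → WorkSym) : LLAction Q T WorkSym :=
  .act next g (fun _ => .stay) dir out orc

/-- The action of the machine of the flow chart `code` at a node of the flow chart. -/
def instrAction (i : InputSym) (g : T → WorkSym) :
    CounterInstr T L → LLAction (CounterCtl T L) T WorkSym
  | .halt => .halt
  | .op (.inc r) next => leaveWork (.carry r true next next) .stay none none g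
  | .op (.move dir) next => leaveWork (.run next) dir none none g
  | .op (.write out orc) next => leaveWork (.run next) .stay out orc g
  | .test (.pos r) yes no => leaveWork (.carry r false yes no) .stay none none g
  | .test (.look p) yes no => leaveWork (.run (bif p i then yes else no)) .stay none none g
  | .test (.answer p) yes no => .query fun a => .run (bif p a then yes else no)

variable [DecidableEq T]

/-- An action on the work tape `r` only, where `g` are the scanned work symbols. -/
def writeOn {Q : Type} (r : T) (next : Q) (a : WorkSym) (dir : HeadMove)
    (g : T → WorkSym) : LLAction Q T WorkSym :=
  .act next (Function.update g r a) (Function.update (fun _ => .stay) r dir) .stay none none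

/-- The transition function of the machine of a flow chart. Incrementing flips the leading digits
`1` and the next `0`, where a blank counts as `0`. Decrementing flips the leading digits `0` and the
next `1`; if there is no digit `1`, then the counter is zero, and the flips are undone. -/
def counterStep (code : L → CounterInstr T L) (start : L) :
    CounterCtl T L → InputSym → (T → WorkSym) → LLAction (CounterCtl T L) T WorkSym
  | .init, _, _ => .act (.run start) (fun _ => .mark) (fun _ => .right) .stay none none
  | .run l, i, g => instrAction i g (code l)
  | .carry r b yes no, _, g => match g r with
    | .bit c => if c = b then writeOn r (.carry r b yes no) (.bit !b) .right g
        else writeOn r (.rewind r false yes) (.bit b) .left g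
    | _ => if b then writeOn r (.rewind r false yes) (.bit true) .left g
        else writeOn r (.rewind r true no) (g r) .left g
  | .rewind r undo l, _, g => match g r with
    | .mark => writeOn r (.run l) .mark .right g
    | a => writeOn r (.rewind r undo l) (if undo then .bit false else a) .left g

/-- The machine that executes a flow chart, with one work tape for each counter. -/
def counterMachine [Finite T] [Finite L] (code : L → CounterInstr T L) (start : L) :
    LLMachine where
  State := CounterCtl T L
  Tape := T
  Γ := WorkSym
  finite_state := inferInstance
  finite_tape := inferInstance
  finite_alphabet := inferInstance
  blank := .blank
  start := .init
  δ := counterStep code start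

end Machine

namespace LLMachine

/-- `M` reaches the second configuration from the first, and all work-tape heads are within the
first `S` cells before each of the steps. -/
def ReachesWithin (M : LLMachine) (f : List TapeSym → List Bool) (inp : List TapeSym) (S : ℕ) :
    M.Config → M.Config → Prop :=
  Relation.ReflTransGen fun a b => M.step f inp a = some b ∧ ∀ t, a.head t < S

variable {M : LLMachine} {f : List TapeSym → List Bool} {inp : List TapeSym} {S : ℕ}
  {a b c : M.Config}

theorem ReachesWithin.head (hstep : M.step f inp a = some b) (ha : ∀ t, a.head t < S)
    (h : M.ReachesWithin f inp S b c) : M.ReachesWithin f inp S a c :=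
  Relation.ReflTransGen.head ⟨hstep, ha⟩ h

theorem ReachesWithin.trans (hab : M.ReachesWithin f inp S a b)
    (hbc : M.ReachesWithin f inp S b c) : M.ReachesWithin f inp S a c :=
  Relation.ReflTransGen.trans hab hbc

theorem ReachesWithin.reaches (h : M.ReachesWithin f inp S a b) :
    StateTransition.Reaches (M.step f inp) a b :=
  Relation.ReflTransGen.mono (fun _ _ h => by simpa using h.1) _ _ h

theorem ReachesWithin.head_lt (h : M.ReachesWithin f inp S a b) (hb : M.step f inp b = none)
    (hbS : ∀ t, b.head t < S) (hc : StateTransition.Reaches (M.step f inp) a c) :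
    ∀ t, c.head t < S := by
  induction h using Relation.ReflTransGen.head_induction_on with
  | refl =>
    rcases Relation.ReflTransGen.cases_head hc with rfl | ⟨d, hd, _⟩
    · exact hbS
    · simp [hb] at hd
  | head hstep _ ih =>
    rcases Relation.ReflTransGen.cases_head hc with rfl | ⟨d, hd, hdc⟩
    · exact hstep.2
    · rw [hstep.1, Option.mem_some_iff] at hd
      subst hd
      exact ih hdc

end LLMachine

section Simulation

variable {T L : Type} [DecidableEq T] [Finite T] [Finite L] {code : L → CounterInstr T L}
  {start : L} {E : RunEnv} {S : ℕ} {σ : CounterState T} {D : T → List Bool} {r : T}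

/-- The configuration with control state `q` and memory `σ`, where the head on the tape `t` is at
the position `h t`, and the tape holds the digits `D t`. -/
def counterConfig (q : CounterCtl T L) (σ : CounterState T) (h : T → ℕ) (D : T → List Bool) :
    (counterMachine code start).Config where
  state := q
  inputHead := σ.inputHead
  head := h
  cell := fun t => workTape (D t)
  oracleTape := σ.oracleTape
  output := σ.output

/-- The configuration in which the tape `r` holds the digits `l` and its head is at the position
`p`, the head on any other tape `t` is at its first digit, and the tape holds the digits `D t`. -/
abbrev tapeConfig (q : CounterCtl T L) (σ : CounterState T) (D : T → List Bool) (r : T)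
    (l : List Bool) (p : ℕ) : (counterMachine code start).Config :=
  counterConfig q σ (Function.update (fun _ => 1) r p) (Function.update D r l)

theorem tapeConfig_one (q : CounterCtl T L) (l : List Bool) :
    tapeConfig (code := code) (start := start) q σ D r l 1 =
      counterConfig q σ (fun _ => 1) (Function.update D r l) := by
  rw [tapeConfig, Function.update_eq_self r fun _ => 1]

theorem head_tapeConfig_lt {q : CounterCtl T L} {l : List Bool} {p : ℕ} (hS : 1 < S)
    (hp : p < S) (t : T) :
    (tapeConfig (code := code) (start := start) q σ D r l p).head t < S := by
  by_cases ht : t = r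
  · simpa [counterConfig, ht] using hp
  · simpa [counterConfig, ht] using hS

theorem step_writeOn (hσ : σ.inputHead ≤ E.input.length + 1) {q : CounterCtl T L}
    (q' : CounterCtl T L) {l l' : List Bool} {p : ℕ} {a : WorkSym} (dir : HeadMove)
    (hq : ∀ i g, g r = workTape l p → counterStep code start q i g = writeOn r q' a dir g)
    (hl : Function.update (workTape l) p a = workTape l') :
    (counterMachine code start).step E.oracle E.input (tapeConfig q σ D r l p) =
      some (tapeConfig q' σ D r l' (LLMachine.moveHead dir p)) := by
  simp only [LLMachine.step, tapeConfig, counterConfig, counterMachine]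
  rw [hq _ _ (by simp)]
  simp only [writeOn, LLMachine.moveHead, min_eq_left hσ, Option.toList_none, List.append_nil,
    Option.some.injEq, LLMachine.Config.mk.injEq, true_and, and_true]
  refine ⟨funext fun t => ?_, funext fun t => ?_⟩ <;> by_cases ht : t = r
  · subst ht; simp
  · simp [ht]
  · subst ht; simp [hl]
  · simp [ht]

theorem step_leaveWork {q q' : CounterCtl T L} {h : T → ℕ} {dir : HeadMove}
    {out : Option Bool} {orc : Option TapeSym}
    (hq : ∀ g, counterStep code start q (LLMachine.scan E.input σ.inputHead) g =
      leaveWork q' dir out orc g)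
    (hdir : LLMachine.moveHead dir σ.inputHead ≤ E.input.length + 1) :
    (counterMachine code start).step E.oracle E.input (counterConfig q σ h D) =
      some (counterConfig q' { σ.write out orc with
        inputHead := LLMachine.moveHead dir σ.inputHead } h D) := by
  simp only [LLMachine.step, counterConfig, counterMachine]
  rw [hq]
  simp only [leaveWork, min_eq_left hdir, CounterState.write, Function.update_eq_self]
  rfl

theorem reachesWithin_rewind (hσ : σ.inputHead ≤ E.input.length + 1) (undo : Bool) (next : L)
    (l l' : List Bool) (hS : l.length + 1 < S) :
    (counterMachine code start).ReachesWithin E.oracle E.input S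
      (tapeConfig (.rewind r undo next) σ D r (l ++ l') l.length)
      (counterConfig (.run next) σ (fun _ => 1)
        (Function.update D r ((if undo then List.replicate l.length false else l) ++ l'))) := by
  induction l using List.reverseRecOn generalizing l' with
  | nil =>
    have hstep : (counterMachine code start).step E.oracle E.input
        (tapeConfig (.rewind r undo next) σ D r l' 0) = some (tapeConfig (.run next) σ D r l' 1) :=
      step_writeOn hσ _ .right (fun _ g hg => by simp only [counterStep, hg, workTape])
        (Function.update_eq_self 0 (workTape l'))
    rw [tapeConfig_one] at hstep
    refine .head hstep (head_tapeConfig_lt (T := T) (by omega) (Nat.zero_lt_of_lt hS)) ?_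
    simpa using .refl
  | append_singleton l b ih =>
    simp only [List.length_append, List.length_singleton, List.append_assoc,
      List.singleton_append] at hS ⊢
    have hstep : (counterMachine code start).step E.oracle E.input
          (tapeConfig (.rewind r undo next) σ D r (l ++ b :: l') (l.length + 1)) =
        some (tapeConfig (.rewind r undo next) σ D r
          (l ++ (if undo then false else b) :: l') l.length) :=
      step_writeOn hσ _ .left
        (fun _ g hg => by cases undo <;> simp only [counterStep, hg, workTape_append_cons] <;> rfl)
        (update_workTape l l' b (if undo then false else b))
    refine .head hstep (head_tapeConfig_lt (T := T) (by omega) (by omega)) ?_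
    have hrest := ih ((if undo then false else b) :: l') (by omega)
    cases undo <;> simpa [List.replicate_succ'] using hrest

theorem reachesWithin_carry (hσ : σ.inputHead ≤ E.input.length + 1) (b : Bool) (yes no : L)
    (k : ℕ) (l l' : List Bool) (hS : l.length + k + 1 < S) :
    (counterMachine code start).ReachesWithin E.oracle E.input S
      (tapeConfig (.carry r b yes no) σ D r (l ++ (List.replicate k b ++ l')) (l.length + 1))
      (tapeConfig (.carry r b yes no) σ D r (l ++ (List.replicate k (!b) ++ l'))
        (l.length + k + 1)) := by
  induction k generalizing l with
  | zero => exact .refl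
  | succ k ih =>
    simp only [List.replicate_succ, List.cons_append]
    have hstep : (counterMachine code start).step E.oracle E.input
          (tapeConfig (.carry r b yes no) σ D r (l ++ b :: (List.replicate k b ++ l'))
            (l.length + 1)) =
        some (tapeConfig (.carry r b yes no) σ D r (l ++ (!b) :: (List.replicate k b ++ l'))
            (l.length + 1 + 1)) :=
      step_writeOn hσ _ .right
        (fun _ g hg => by simp only [counterStep, hg, workTape_append_cons, if_true])
        (update_workTape l (List.replicate k b ++ l') b !b)
    refine .head hstep (head_tapeConfig_lt (T := T) (by omega) (by omega)) ?_
    have hrest := ih (l ++ [!b]) (by simp only [List.length_append, List.length_singleton]; omega)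
    simpa [add_assoc, add_comm, add_left_comm] using hrest

theorem reachesWithin_flip (hσ : σ.inputHead ≤ E.input.length + 1) (b : Bool) (yes no : L)
    (k : ℕ) (l : List Bool) (hS : k + 1 < S) :
    (counterMachine code start).ReachesWithin E.oracle E.input S
      (tapeConfig (.carry r b yes no) σ D r (List.replicate k b ++ (!b) :: l) 1)
      (counterConfig (.run yes) σ (fun _ => 1)
        (Function.update D r (List.replicate k (!b) ++ b :: l))) := by
  have hcarry := reachesWithin_carry (code := code) (start := start) (D := D) (r := r) hσ b yes no
    k [] ((!b) :: l) (by simpa using hS)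
  have hlen : (List.replicate k (!b)).length = k := List.length_replicate
  have hstep : (counterMachine code start).step E.oracle E.input
        (tapeConfig (.carry r b yes no) σ D r (List.replicate k (!b) ++ (!b) :: l) (k + 1)) =
      some (tapeConfig (.rewind r false yes) σ D r (List.replicate k (!b) ++ b :: l) k) :=
    step_writeOn (a := .bit b) hσ _ .left (fun _ g hg => by
      have hread := workTape_append_cons (List.replicate k (!b)) l (!b)
      rw [hlen] at hread
      simp only [counterStep, hg, hread, Bool.not_eq_self, if_false])
      (by simpa only [hlen] using update_workTape (List.replicate k (!b)) l (!b) b)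
  have hrewind := reachesWithin_rewind (code := code) (start := start) (D := D) (r := r) hσ false
    yes (List.replicate k (!b)) (b :: l) (by simpa using hS)
  rw [hlen] at hrewind
  refine LLMachine.ReachesWithin.trans (by simpa using hcarry) (.head hstep ?_ hrewind)
  exact head_tapeConfig_lt (T := T) (by omega) hS

theorem reachesWithin_overflow (hσ : σ.inputHead ≤ E.input.length + 1) (yes no : L) (k : ℕ)
    (hS : k + 1 < S) :
    (counterMachine code start).ReachesWithin E.oracle E.input S
      (tapeConfig (.carry r true yes no) σ D r (List.replicate k true) 1)
      (counterConfig (.run yes) σ (fun _ => 1)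
        (Function.update D r (List.replicate k false ++ [true]))) := by
  have hcarry := reachesWithin_carry (code := code) (start := start) (D := D) (r := r) hσ true
    yes no k [] [] (by simpa using hS)
  have hlen : (List.replicate k false).length = k := List.length_replicate
  have hstep : (counterMachine code start).step E.oracle E.input
        (tapeConfig (.carry r true yes no) σ D r (List.replicate k false) (k + 1)) =
      some (tapeConfig (.rewind r false yes) σ D r (List.replicate k false ++ [true]) k) :=
    step_writeOn (a := .bit true) hσ _ .left (fun _ g hg => by
      have hread := workTape_length_succ (List.replicate k false)
      rw [hlen] at hread
      simp only [counterStep, hg, hread, if_true])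
      (by simpa only [hlen] using update_workTape_concat (List.replicate k false) true)
  have hrewind := reachesWithin_rewind (code := code) (start := start) (D := D) (r := r) hσ false
    yes (List.replicate k false) [true] (by simpa using hS)
  rw [hlen] at hrewind
  refine LLMachine.ReachesWithin.trans (by simpa using hcarry) (.head hstep ?_ hrewind)
  exact head_tapeConfig_lt (T := T) (by omega) hS

theorem reachesWithin_underflow (hσ : σ.inputHead ≤ E.input.length + 1) (yes no : L) (k : ℕ)
    (hS : k + 1 < S) :
    (counterMachine code start).ReachesWithin E.oracle E.input S
      (tapeConfig (.carry r false yes no) σ D r (List.replicate k false) 1)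
      (counterConfig (.run no) σ (fun _ => 1)
        (Function.update D r (List.replicate k false))) := by
  have hcarry := reachesWithin_carry (code := code) (start := start) (D := D) (r := r) hσ false
    yes no k [] [] (by simpa using hS)
  have hlen : (List.replicate k true).length = k := List.length_replicate
  have hstep : (counterMachine code start).step E.oracle E.input
        (tapeConfig (.carry r false yes no) σ D r (List.replicate k true) (k + 1)) =
      some (tapeConfig (.rewind r true no) σ D r (List.replicate k true) k) :=
    step_writeOn hσ _ .left (fun _ g hg => by
      have hread := workTape_length_succ (List.replicate k true)
      rw [hlen] at hread
      simp only [counterStep, hg, hread, Bool.false_eq_true, if_false])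
      (Function.update_eq_self _ _)
  have hrewind := reachesWithin_rewind (code := code) (start := start) (D := D) (r := r) hσ true
    no (List.replicate k true) [] (by simpa using hS)
  rw [hlen] at hrewind
  refine LLMachine.ReachesWithin.trans (by simpa using hcarry)
    (.head hstep ?_ (by simpa using hrewind))
  exact head_tapeConfig_lt (T := T) (by omega) hS

/-- The number of cells of each tape that suffices for counters up to the bound. -/
def RunEnv.space (E : RunEnv) : ℕ := Nat.log 2 E.bound + 3

/-- The tapes hold the values of the counters, possibly with leading zeros, and they are not too
long. -/
structure Represents (E : RunEnv) (σ : CounterState T) (D : T → List Bool) : Prop where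
  inputHead_le : σ.inputHead ≤ E.input.length + 1
  binVal_eq (t : T) : binVal (D t) = σ.reg t
  length_le (t : T) : 2 ^ (D t).length ≤ 2 * E.bound

omit [Finite T] in
theorem Represents.update (h : Represents E σ D) (r : T) {n : ℕ} {l : List Bool}
    (hn : binVal l = n) (hl : 2 ^ l.length ≤ 2 * E.bound) :
    Represents E (σ.set r n) (Function.update D r l) := by
  refine ⟨h.inputHead_le, fun t => ?_, fun t => ?_⟩ <;> by_cases ht : t = r
  · simpa [CounterState.set, ht] using hn
  · simpa [CounterState.set, ht] using h.binVal_eq t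
  · simpa [ht] using hl
  · simpa [ht] using h.length_le t

theorem length_add_one_lt_space {l : List Bool} (h : 2 ^ l.length ≤ 2 * E.bound) :
    l.length + 1 < E.space := by
  have hbound : E.bound ≠ 0 := by rintro h0; simp [h0] at h
  have hlog := Nat.le_log_of_pow_le one_lt_two h
  rw [mul_comm, Nat.log_mul_base one_lt_two hbound] at hlog
  simp only [RunEnv.space]
  omega

theorem Represents.reachesWithin_inc (h : Represents E σ D) (hr : σ.reg r < E.bound) (yes no : L) :
    ∃ D', Represents E (σ.set r (σ.reg r + 1)) D' ∧
      (counterMachine code start).ReachesWithin E.oracle E.input E.space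
        (counterConfig (.carry r true yes no) σ (fun _ => 1) D)
        (counterConfig (.run yes) (σ.set r (σ.reg r + 1)) (fun _ => 1) D') := by
  have hspace := length_add_one_lt_space (h.length_le r)
  have hlen := h.length_le r
  have hstart := tapeConfig_one (code := code) (start := start) (σ := σ) (D := D) (r := r)
    (.carry r true yes no) (D r)
  rw [Function.update_eq_self] at hstart
  rw [← hstart]
  have hval := h.binVal_eq r
  rcases eq_replicate_append_not_cons_or true (D r) with ⟨k, l, hl⟩ | ⟨k, hl⟩ <;>
    rw [hl] at hlen hspace hval ⊢
  · refine ⟨_, h.update r ?_ (by simpa using hlen), reachesWithin_flip h.inputHead_le _ _ _ _ _ ?_⟩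
    · rw [← hval]
      exact (binVal_carry k l).symm
    · simp only [List.length_append, List.length_replicate] at hspace
      omega
  · refine ⟨_, h.update r ?_ ?_,
      reachesWithin_overflow h.inputHead_le _ _ _ (by simpa using hspace)⟩
    · rw [← hval, binVal_replicate_true, binVal_append, binVal_replicate_false,
        List.length_replicate]
      simp [binVal]
    · have := binVal_replicate_true k
      simp only [List.length_append, List.length_replicate, List.length_singleton, pow_succ]
      omega

theorem Represents.reachesWithin_dec (h : Represents E σ D) (yes no : L) :
    ∃ D', Represents E (σ.set r (σ.reg r - 1)) D' ∧
      (counterMachine code start).ReachesWithin E.oracle E.input E.space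
        (counterConfig (.carry r false yes no) σ (fun _ => 1) D)
        (counterConfig (.run (bif 0 < σ.reg r then yes else no)) (σ.set r (σ.reg r - 1))
          (fun _ => 1) D') := by
  have hspace := length_add_one_lt_space (h.length_le r)
  have hlen := h.length_le r
  have hstart := tapeConfig_one (code := code) (start := start) (σ := σ) (D := D) (r := r)
    (.carry r false yes no) (D r)
  rw [Function.update_eq_self] at hstart
  rw [← hstart]
  have hval := h.binVal_eq r
  rcases eq_replicate_append_not_cons_or false (D r) with ⟨k, l, hl⟩ | ⟨k, hl⟩ <;>
    rw [hl] at hlen hspace hval ⊢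
  · have hcarry := binVal_carry k l
    rw [Bool.not_false] at hval
    rw [hval] at hcarry
    rw [← hcarry]
    refine ⟨_, h.update r rfl (by simpa using hlen), reachesWithin_flip h.inputHead_le _ _ _ _ _ ?_⟩
    simp only [List.length_append, List.length_replicate] at hspace
    omega
  · rw [binVal_replicate_false] at hval
    rw [← hval]
    exact ⟨_, h.update r (binVal_replicate_false k) hlen,
      reachesWithin_underflow h.inputHead_le _ _ _ (by simpa using hspace)⟩

theorem RunEnv.one_lt_space (E : RunEnv) : 1 < E.space := by
  simp only [RunEnv.space]
  omega

theorem Represents.reachesWithin_op (h : Represents E σ D) {l n : L} {a : CounterOp T}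
    (hl : code l = .op a n) (ha : a.Legal E σ) :
    ∃ D', Represents E (a.apply σ) D' ∧
      (counterMachine code start).ReachesWithin E.oracle E.input E.space
        (counterConfig (.run l) σ (fun _ => 1) D)
        (counterConfig (.run n) (a.apply σ) (fun _ => 1) D') := by
  have hS : ∀ _ : T, 1 < E.space := fun _ => E.one_lt_space
  cases a with
  | inc r =>
    obtain ⟨D', hD', hrun⟩ := h.reachesWithin_inc (code := code) (start := start) ha n n
    refine ⟨D', hD', .head (step_leaveWork (q' := .carry r true n n) (dir := .stay) (out := none)
      (orc := none) (fun g => ?_) h.inputHead_le) hS ?_⟩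
    · simp only [counterStep, hl, instrAction]
    · simpa [CounterState.write, LLMachine.moveHead, CounterOp.apply] using hrun
  | move dir =>
    refine ⟨D, ⟨ha, h.binVal_eq, h.length_le⟩, .head (step_leaveWork (q' := .run n) (dir := dir)
      (out := none) (orc := none) (fun g => ?_) ha) hS ?_⟩
    · simp only [counterStep, hl, instrAction]
    · simpa [CounterState.write, CounterOp.apply] using .refl
  | write out orc =>
    refine ⟨D, ⟨h.inputHead_le, h.binVal_eq, h.length_le⟩, .head (step_leaveWork (q' := .run n)
      (dir := .stay) (out := out) (orc := orc) (fun g => ?_) h.inputHead_le) hS ?_⟩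
    · simp only [counterStep, hl, instrAction]
    · exact .refl

theorem Represents.reachesWithin_test (h : Represents E σ D) {l y n : L} {t : CounterTest T}
    (hl : code l = .test t y n) :
    ∃ D', Represents E (t.after σ) D' ∧
      (counterMachine code start).ReachesWithin E.oracle E.input E.space
        (counterConfig (.run l) σ (fun _ => 1) D)
        (counterConfig (.run (bif t.holds E σ then y else n)) (t.after σ) (fun _ => 1) D') := by
  have hS : ∀ _ : T, 1 < E.space := fun _ => E.one_lt_space
  cases t with
  | pos r =>
    obtain ⟨D', hD', hrun⟩ := h.reachesWithin_dec (code := code) (start := start) (r := r) y n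
    refine ⟨D', hD', .head (step_leaveWork (q' := .carry r false y n) (dir := .stay) (out := none)
      (orc := none) (fun g => ?_) h.inputHead_le) hS ?_⟩
    · simp only [counterStep, hl, instrAction]
    · simpa [CounterState.write, LLMachine.moveHead, CounterTest.after, CounterTest.holds]
        using hrun
  | look p =>
    refine ⟨D, h, .head (step_leaveWork (dir := .stay) (out := none) (orc := none)
      (q' := .run (bif p (LLMachine.scan E.input σ.inputHead) then y else n))
      (fun g => ?_) h.inputHead_le) hS ?_⟩
    · simp only [counterStep, hl, instrAction]
    · simpa [CounterState.write, LLMachine.moveHead, CounterTest.after, CounterTest.holds]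
        using .refl
  | answer p =>
    refine ⟨D, ⟨h.inputHead_le, h.binVal_eq, h.length_le⟩, .head ?_ hS .refl⟩
    simp only [LLMachine.step, counterConfig, counterMachine, counterStep, hl, instrAction]
    rfl

theorem Represents.reachesWithin_of_reaches {l l' : L} {σ σ' : CounterState T}
    (h : Represents E σ D)
    (hrun : Relation.ReflTransGen (FlowStep E code) (l, σ) (l', σ')) :
    ∃ D', Represents E σ' D' ∧
      (counterMachine code start).ReachesWithin E.oracle E.input E.space
        (counterConfig (.run l) σ (fun _ => 1) D)
        (counterConfig (.run l') σ' (fun _ => 1) D') := by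
  obtain ⟨b, hb⟩ : ∃ b, b = (l', σ') := ⟨_, rfl⟩
  rw [← hb] at hrun
  induction hrun generalizing l' σ' with
  | refl =>
    obtain ⟨rfl, rfl⟩ := Prod.mk.inj hb
    exact ⟨D, h, .refl⟩
  | tail _ hstep ih =>
    obtain ⟨D₁, hD₁, hrun₁⟩ := ih rfl
    cases hstep with
    | op hl ha =>
      obtain ⟨rfl, rfl⟩ := Prod.mk.inj hb
      obtain ⟨D₂, hD₂, hrun₂⟩ := hD₁.reachesWithin_op hl ha
      exact ⟨D₂, hD₂, hrun₁.trans hrun₂⟩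
    | test hl =>
      obtain ⟨rfl, rfl⟩ := Prod.mk.inj hb
      obtain ⟨D₂, hD₂, hrun₂⟩ := hD₁.reachesWithin_test hl
      exact ⟨D₂, hD₂, hrun₁.trans hrun₂⟩

end Simulation

namespace CounterProg

variable {R : Type} [Finite R]

/-- The flow chart of a program, with an additional node `none` at which it halts. -/
def code (P : CounterProg R) : Option P.Label → CounterInstr (R ⊕ P.Local) (Option P.Label)
  | none => .halt
  | some l => P.instr Sum.inl Sum.inr some none l

open Classical in
/-- The machine that executes a program. -/
noncomputable def machine (P : CounterProg R) : LLMachine :=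
  have := P.finite_label
  have := P.finite_local
  counterMachine P.code (some P.entry)

open Classical in
theorem Runs.machine_reachesWithin {P : CounterProg R} {E : RunEnv} {σ : CounterState R}
    (h : P.Runs E .zero σ) (hE : 0 < E.bound) :
    ∃ c, P.machine.ReachesWithin E.oracle E.input E.space P.machine.init c ∧
      P.machine.step E.oracle E.input c = none ∧ c.output = σ.output ∧ ∀ t, c.head t < E.space := by
  have := P.finite_label
  have := P.finite_local
  have hlayout : IsLayout (Sum.inl : R → R ⊕ P.Local) Sum.inr fun _ => 0 :=
    ⟨Sum.inl_injective, Sum.inr_injective, fun _ _ => Sum.inl_ne_inr, fun _ => rfl⟩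
  have hflow := h.reaches_exit (code := P.code) (node := some) (exit := none) hlayout fun _ => rfl
  have hinit : Represents E (CounterState.zero.extend (Sum.inl : R → R ⊕ P.Local) fun _ => 0)
      fun _ => [] := by
    refine ⟨Nat.zero_le _, fun t => ?_, fun _ => by simpa using by omega⟩
    rcases t with r | k
    · simp [CounterState.extend, CounterState.zero, binVal]
    · simp [CounterState.extend, binVal]
  obtain ⟨D, -, hrun⟩ := hinit.reachesWithin_of_reaches (start := some P.entry) hflow
  have hmark : Function.update (fun _ => WorkSym.blank) 0 .mark = workTape [] := by
    funext p
    cases p <;> simp [workTape]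
  refine ⟨_, .head (b := counterConfig (.run (some P.entry)) _ (fun _ => 1) fun _ => []) ?_
    (fun _ => E.one_lt_space.trans' one_pos) hrun, rfl, rfl, fun _ => E.one_lt_space⟩
  rw [counterConfig, ← hmark]
  rfl

theorem Runs.machine_computes {P : CounterProg R} {E : RunEnv} {σ : CounterState R}
    (h : P.Runs E .zero σ) (hE : 0 < E.bound) :
    P.machine.Computes E.oracle E.input σ.output ∧
      P.machine.UsesSpaceAtMost E.oracle E.input E.space := by
  obtain ⟨c, hreach, hhalt, hout, hhead⟩ := h.machine_reachesWithin hE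
  exact ⟨⟨c, hreach.reaches, hhalt, hout⟩, fun c' hc' => hreach.head_lt hhalt hhead hc'⟩

end CounterProg

namespace CounterState

variable {R : Type} (σ : CounterState R)

@[simp, grind =]
theorem reg_set_self (r : R) (n : ℕ) : (σ.set r n).reg r = n := by
  simp [set]

@[simp, grind =]
theorem reg_set_of_ne {r t : R} (h : t ≠ r) (n : ℕ) : (σ.set r n).reg t = σ.reg t := by
  simp [set, h]

@[simp, grind =]
theorem set_set (r : R) (n k : ℕ) : (σ.set r n).set r k = σ.set r k := by
  simp [set]

@[simp]
theorem set_reg_self (r : R) : σ.set r (σ.reg r) = σ := by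
  simp [set]

theorem set_comm {r t : R} (h : r ≠ t) (n k : ℕ) :
    (σ.set r n).set t k = (σ.set t k).set r n := by
  classical
  simp only [set, CounterState.mk.injEq, and_true]
  exact Function.update_comm h _ _ _

@[simp, grind =]
theorem set_push_none (n k : ℕ) : (σ.push n).set none k = σ.push k := by
  ext t
  · cases t <;> simp [set, push]
  all_goals rfl

@[simp, grind =]
theorem set_push_some (n : ℕ) (r : R) (k : ℕ) :
    (σ.push n).set (some r) k = (σ.set r k).push n := by
  ext t
  · rcases t with _ | t
    · simp [set, push]
    · by_cases ht : t = r <;> simp [set, push, ht]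
  all_goals rfl

@[simp, grind =]
theorem reg_push_none (n : ℕ) : (σ.push n).reg none = n := rfl

@[simp, grind =]
theorem reg_push_some (n : ℕ) (r : R) : (σ.push n).reg (some r) = σ.reg r := rfl

@[simp, grind =]
theorem inputHead_push (n : ℕ) : (σ.push n).inputHead = σ.inputHead := rfl

end CounterState

namespace CounterProg

variable {R : Type} {E : RunEnv} {σ τ : CounterState R} {A B : CounterProg R} {a b c r : R}

theorem Runs.of_eq (h : A.Runs E σ τ) {τ' : CounterState R} (hτ : τ = τ') : A.Runs E σ τ' :=
  hτ ▸ h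

/-! ### Arithmetic -/

theorem runs_write (out : Option Bool) (orc : Option TapeSym) :
    (op (.write out orc)).Runs E σ (σ.write out orc) :=
  .op trivial

def skip : CounterProg R := op (.write none none)

theorem runs_skip : skip.Runs E σ σ :=
  (runs_write none none).of_eq (by simp [CounterState.write])

def inc (r : R) : CounterProg R := op (.inc r)

theorem runs_inc (h : σ.reg r < E.bound) : (inc r).Runs E σ (σ.set r (σ.reg r + 1)) :=
  .op h

theorem runs_loop_pos (r : R) {n : ℕ} (h : ℕ → CounterState R)
    (hA : ∀ i < n, A.Runs E ((h i).set r (n - 1 - i)) ((h (i + 1)).set r (n - 1 - i))) :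
    (loop (.pos r) A).Runs E ((h 0).set r n) ((h n).set r 0) := by
  induction n generalizing h with
  | zero => exact (Runs.loop_done (by simp [CounterTest.holds])).of_eq (by simp [CounterTest.after])
  | succ n ih =>
    refine .loop_step (by simp [CounterTest.holds]) ?_ (ih (fun i => h (i + 1)) fun i hi => ?_)
    · simpa [CounterTest.after] using hA 0 n.succ_pos
    · simpa [Nat.sub_sub, add_comm] using hA (i + 1) (by omega)

def clear (r : R) : CounterProg R := loop (.pos r) skip

theorem runs_clear (r : R) : (clear r).Runs E σ (σ.set r 0) := by
  simpa [clear] using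
    runs_loop_pos (E := E) r (n := σ.reg r) (fun _ => σ) fun _ _ => runs_skip

def dec (r : R) : CounterProg R := branch (.pos r) skip skip

theorem runs_dec : (dec r).Runs E σ (σ.set r (σ.reg r - 1)) := by
  by_cases h : 0 < σ.reg r
  · exact .branch_true (by simpa [CounterTest.holds] using h) runs_skip
  · exact .branch_false (by simpa [CounterTest.holds] using h) runs_skip

/-- An expression: a program that computes a value in the counter `none`. -/
def Evals (E : RunEnv) (A : CounterProg (Option R)) (σ : CounterState R) (n : ℕ) : Prop :=
  A.Runs E (σ.push 0) (σ.push n)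

def letIn (A B : CounterProg (Option R)) : CounterProg R := new (seq A (seq B (clear none)))

theorem Runs.letIn {A B : CounterProg (Option R)} {σ' : CounterState R} {n k : ℕ}
    (hA : A.Runs E (σ.push 0) (σ'.push n)) (hB : B.Runs E (σ'.push n) (τ.push k)) :
    (A.letIn B).Runs E σ τ :=
  .new (.seq hA (.seq hB ((runs_clear none).of_eq (by simp))))

def moveTo (a b : R) : CounterProg R := loop (.pos a) (inc b)

theorem runs_moveTo (hab : a ≠ b) (h : σ.reg b + σ.reg a ≤ E.bound) :
    (moveTo a b).Runs E σ ((σ.set b (σ.reg b + σ.reg a)).set a 0) := by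
  have hloop := runs_loop_pos (E := E) (A := inc b) a (n := σ.reg a)
    (fun i => σ.set b (σ.reg b + i)) fun i hi => (runs_inc (by grind)).of_eq ?_
  · simpa [moveTo] using hloop
  · rw [CounterState.set_comm _ hab.symm]
    simp [hab.symm, CounterState.set_comm _ hab, add_assoc]

def addTo (a b : R) : CounterProg R :=
  new (seq (loop (.pos (some a)) (seq (inc (some b)) (inc none))) (moveTo none (some a)))

theorem runs_addTo (hab : a ≠ b) (h : σ.reg b + σ.reg a ≤ E.bound) :
    (addTo a b).Runs E σ (σ.set b (σ.reg b + σ.reg a)) := by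
  have hloop := runs_loop_pos (E := E) (A := seq (inc (some b)) (inc none)) (some a)
    (n := σ.reg a) (fun i => (σ.set b (σ.reg b + i)).push i) fun i hi =>
      .seq (runs_inc (by grind)) ((runs_inc (by grind)).of_eq ?_)
  · simp only [CounterState.set_push_some, add_zero, CounterState.set_reg_self] at hloop
    refine .new (.seq hloop ((runs_moveTo (Option.some_ne_none a).symm (by grind)).of_eq ?_))
    simp [hab, CounterState.set_comm _ hab.symm]
  · simp [hab.symm, CounterState.set_comm _ hab, add_assoc]

def mulAddTo (a b c : R) : CounterProg R :=
  letIn (addTo (some a) none) (loop (.pos none) (addTo (some b) (some c)))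

theorem evals_addTo (h : σ.reg a ≤ E.bound) :
    (addTo (some a) none).Evals E σ (σ.reg a) :=
  (runs_addTo (Option.some_ne_none a) (by simpa using h)).of_eq (by simp)

theorem runs_mulAddTo (hbc : b ≠ c) (ha : σ.reg a ≤ E.bound)
    (h : σ.reg c + σ.reg a * σ.reg b ≤ E.bound) :
    (mulAddTo a b c).Runs E σ (σ.set c (σ.reg c + σ.reg a * σ.reg b)) := by
  have hloop := runs_loop_pos (E := E) (A := addTo (some b) (some c)) none (n := σ.reg a)
    (fun i => (σ.set c (σ.reg c + i * σ.reg b)).push 0) fun i hi => (runs_addTo ?_ ?_).of_eq ?_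
  · exact Runs.letIn (evals_addTo ha) (by simpa using hloop)
  · simpa using hbc
  · have hle : (i + 1) * σ.reg b ≤ σ.reg a * σ.reg b := Nat.mul_le_mul_right _ hi
    rw [add_one_mul] at hle
    simpa [hbc] using (by omega : σ.reg c + i * σ.reg b + σ.reg b ≤ E.bound)
  · simp [hbc, add_one_mul, add_assoc]

def double (r : R) : CounterProg R :=
  letIn (moveTo (some r) none) (loop (.pos none) (seq (inc (some r)) (inc (some r))))

theorem runs_double (h : 2 * σ.reg r ≤ E.bound) :
    (double r).Runs E σ (σ.set r (2 * σ.reg r)) := by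
  have hmove := runs_moveTo (E := E) (σ := σ.push 0) (Option.some_ne_none r) (by grind)
  have hloop := runs_loop_pos (E := E) (A := seq (inc (some r)) (inc (some r))) none
    (n := σ.reg r) (fun i => (σ.set r (2 * i)).push 0) fun i hi =>
      .seq (runs_inc (by grind)) ((runs_inc (by grind)).of_eq ?_)
  · exact .letIn (σ' := σ.set r 0) (n := σ.reg r) (hmove.of_eq (by simp)) (by simpa using hloop)
  · simp [mul_add]

def subFrom (a b : R) : CounterProg R :=
  letIn (addTo (some a) none) (loop (.pos none) (dec (some b)))

theorem runs_subFrom (h : σ.reg a ≤ E.bound) :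
    (subFrom a b).Runs E σ (σ.set b (σ.reg b - σ.reg a)) := by
  have hloop := runs_loop_pos (E := E) (A := dec (some b)) none (n := σ.reg a)
    (fun i => (σ.set b (σ.reg b - i)).push 0) fun i _ => runs_dec.of_eq ?_
  · exact Runs.letIn (evals_addTo h) (by simpa using hloop)
  · simp [Nat.sub_sub]

end CounterProg

/-! ### Loops and comparisons -/

namespace CounterProg

variable {R : Type} {E : RunEnv} {σ τ : CounterState R}

def forLt (r : R) (A : CounterProg (Option (Option R))) : CounterProg R :=
  letIn (addTo (some r) none) (new (seq (loop (.pos (some none)) (seq A (inc none))) (clear none)))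

theorem runs_forLt {r : R} {A : CounterProg (Option (Option R))} {n : ℕ} (h : ℕ → CounterState R)
    (hr : (h 0).reg r = n) (hn : n ≤ E.bound)
    (hA : ∀ i < n, ∀ k, A.Runs E (((h i).push k).push i) (((h (i + 1)).push k).push i)) :
    (forLt r A).Runs E (h 0) (h n) := by
  have hloop := runs_loop_pos (E := E) (A := seq A (inc none)) (some none) (n := n)
    (fun i => ((h i).push 0).push i) fun i hi =>
      .seq (by simpa using hA i hi (n - 1 - i)) ((runs_inc (by grind)).of_eq (by simp))
  have hcopy := evals_addTo (E := E) (σ := h 0) (a := r) (by omega)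
  rw [hr] at hcopy
  exact .letIn (k := 0) hcopy (.new (.seq (by simpa using hloop)
    ((runs_clear none).of_eq (by simp))))

def ifLt (a b : R) (A B : CounterProg (Option R)) : CounterProg R :=
  letIn (addTo (some b) none)
    (seq (subFrom (some a) none) (branch (.pos none) (seq (clear none) A) B))

theorem runs_ifLt {a b : R} {A B : CounterProg (Option R)} (ha : σ.reg a ≤ E.bound)
    (hb : σ.reg b ≤ E.bound)
    (hA : σ.reg a < σ.reg b → A.Runs E (σ.push 0) (τ.push 0))
    (hB : ¬ σ.reg a < σ.reg b → B.Runs E (σ.push 0) (τ.push 0)) :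
    (ifLt a b A B).Runs E σ τ := by
  have hsub := (runs_subFrom (E := E) (σ := σ.push (σ.reg b)) (a := some a) (b := none) ha).of_eq
    (CounterState.set_push_none ..)
  refine .letIn (k := 0) (evals_addTo hb) (.seq hsub ?_)
  by_cases hab : σ.reg a < σ.reg b
  · refine .branch_true (by simpa [CounterTest.holds] using hab) (.seq (runs_clear none) ?_)
    simpa [CounterTest.after] using hA hab
  · refine .branch_false (by simpa [CounterTest.holds] using hab) ?_
    simpa [CounterTest.after, Nat.sub_eq_zero_of_le (not_lt.1 hab)] using hB hab

def const : ℕ → CounterProg (Option R)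
  | 0 => skip
  | n + 1 => seq (const n) (inc none)

theorem evals_const {n : ℕ} (hn : n ≤ E.bound) : (const n).Evals E σ n := by
  induction n with
  | zero => exact runs_skip
  | succ n ih =>
    exact .seq (ih (by omega)) ((runs_inc (r := none) (σ := σ.push n) hn).of_eq (by simp))

def powTwo (r : R) : CounterProg (Option R) :=
  seq (inc none) (forLt (some r) (double (some (some none))))

theorem evals_powTwo {r : R} (hr : σ.reg r ≤ E.bound) (h : 2 ^ σ.reg r ≤ E.bound) :
    (powTwo r).Evals E σ (2 ^ σ.reg r) := by
  have hfor := runs_forLt (E := E) (r := some r) (A := double (some (some none)))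
    (fun i => σ.push (2 ^ i)) rfl hr fun i hi k => (runs_double ?_).of_eq (by simp [pow_succ'])
  · exact .seq ((runs_inc (Nat.two_pow_pos _ |>.trans_le h)).of_eq (by simp)) hfor
  · have hle : 2 ^ (i + 1) ≤ 2 ^ σ.reg r := Nat.pow_le_pow_right two_pos hi
    simpa [pow_succ'] using hle.trans h

end CounterProg

/-! ### Writing numbers -/

/-- The two write-only tapes. -/
inductive Channel : Type
  | output
  | oracle

namespace CounterState

variable {R : Type} (σ : CounterState R)

def tell (l : List TapeSym) : CounterState R := { σ with oracleTape := σ.oracleTape ++ l }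

/-- Writing bits on one of the two write-only tapes. -/
def emit : Channel → List Bool → CounterState R
  | .output, l => { σ with output := σ.output ++ l }
  | .oracle, l => σ.tell (l.map .bit)

@[simp]
theorem tell_push (n : ℕ) (l : List TapeSym) : (σ.push n).tell l = (σ.tell l).push n := rfl

@[simp]
theorem tell_tell (l l' : List TapeSym) : (σ.tell l).tell l' = σ.tell (l ++ l') := by
  simp [tell]

@[simp]
theorem tell_nil : σ.tell [] = σ := by
  simp [tell]

@[simp, grind =]
theorem reg_tell (l : List TapeSym) (r : R) : (σ.tell l).reg r = σ.reg r := rfl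

@[simp]
theorem emit_push (n : ℕ) (ch : Channel) (l : List Bool) :
    (σ.push n).emit ch l = (σ.emit ch l).push n := by
  cases ch <;> rfl

@[simp]
theorem emit_set (r : R) (n : ℕ) (ch : Channel) (l : List Bool) :
    (σ.set r n).emit ch l = (σ.emit ch l).set r n := by
  cases ch <;> rfl

@[simp]
theorem emit_emit (ch : Channel) (l l' : List Bool) :
    (σ.emit ch l).emit ch l' = σ.emit ch (l ++ l') := by
  cases ch <;> simp [emit]

@[simp]
theorem emit_nil (ch : Channel) : σ.emit ch [] = σ := by
  cases ch <;> simp [emit]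

@[simp, grind =]
theorem reg_emit (ch : Channel) (l : List Bool) (r : R) : (σ.emit ch l).reg r = σ.reg r := by
  cases ch <;> rfl

end CounterState

namespace CounterProg

variable {R : Type} {E : RunEnv} {σ : CounterState R}

def emit : Channel → Bool → CounterProg R
  | .output, b => op (.write b none)
  | .oracle, b => op (.write none (some (.bit b)))

theorem runs_emit (ch : Channel) (b : Bool) : (emit ch b).Runs E σ (σ.emit ch [b]) := by
  cases ch
  · exact (runs_write _ _).of_eq (by simp [CounterState.write, CounterState.emit])
  · exact (runs_write _ _).of_eq
      (by simp [CounterState.write, CounterState.emit, CounterState.tell])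

def divModTwo (r : R) : CounterProg (Option (Option R)) :=
  loop (.pos (some (some r))) (branch (.pos none) (inc (some none)) (inc none))

theorem runs_divModTwo {r : R} (hr : σ.reg r ≤ E.bound) :
    (divModTwo r).Runs E ((σ.push 0).push 0)
      (((σ.set r 0).push (σ.reg r / 2)).push (σ.reg r % 2)) := by
  have hloop := runs_loop_pos (E := E) (A := branch (.pos none) (inc (some none)) (inc none))
    (some (some r)) (n := σ.reg r) (fun i => (σ.push (i / 2)).push (i % 2)) fun i hi => ?_
  · simpa [divModTwo] using hloop
  · rcases Nat.mod_two_eq_zero_or_one i with h0 | h1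
    · refine .branch_false (by simp [CounterTest.holds, h0]) ((runs_inc ?_).of_eq ?_)
      · simp only [CounterTest.after]
        grind
      · have hdiv : (i + 1) / 2 = i / 2 := by omega
        have hmod : (i + 1) % 2 = 1 := by omega
        simp [CounterTest.after, h0, hdiv, hmod]
    · refine .branch_true (by simp [CounterTest.holds, h1]) ((runs_inc ?_).of_eq ?_)
      · simp only [CounterTest.after]
        grind
      · have hdiv : (i + 1) / 2 = i / 2 + 1 := by omega
        have hmod : (i + 1) % 2 = 0 := by omega
        simp [CounterTest.after, h1, hdiv, hmod]

def shiftOut (ch : Channel) (r : R) : CounterProg R :=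
  new (new (seq (divModTwo r) (seq (branch (.pos none) (emit ch true) (emit ch false))
    (moveTo (some none) (some (some r))))))

theorem runs_shiftOut (ch : Channel) {r : R} (hr : σ.reg r ≤ E.bound) :
    (shiftOut ch r).Runs E σ ((σ.set r (σ.reg r / 2)).emit ch [(σ.reg r).testBit 0]) := by
  let τ := ((σ.set r 0).push (σ.reg r / 2)).push 0
  have hbit : (branch (.pos none) (emit ch true) (emit ch false)).Runs E
      (((σ.set r 0).push (σ.reg r / 2)).push (σ.reg r % 2))
      (τ.emit ch [(σ.reg r).testBit 0]) := by
    rcases Nat.mod_two_eq_zero_or_one (σ.reg r) with h0 | h1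
    · refine .branch_false (by simp [CounterTest.holds, h0]) ((runs_emit ch false).of_eq ?_)
      simp [CounterTest.after, h0, τ]
    · refine .branch_true (by simp [CounterTest.holds, h1]) ((runs_emit ch true).of_eq ?_)
      simp [CounterTest.after, h1, τ]
  have hmove := runs_moveTo (E := E) (σ := τ.emit ch [(σ.reg r).testBit 0])
    (a := some none) (b := some (some r)) (by simp) (by grind)
  exact .new (.new (.seq (runs_divModTwo hr) (.seq hbit (hmove.of_eq (by simp [τ])))))

def putFixed (ch : Channel) (n r : R) : CounterProg R :=
  letIn (addTo (some r) none) (forLt (some n) (shiftOut ch (some (some none))))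

theorem runs_putFixed (ch : Channel) {n r : R} (hn : σ.reg n ≤ E.bound) (hr : σ.reg r ≤ E.bound) :
    (putFixed ch n r).Runs E σ (σ.emit ch ((List.range (σ.reg n)).map (σ.reg r).testBit)) := by
  have hfor := runs_forLt (E := E) (r := some n) (A := shiftOut ch (some (some none)))
    (fun i => (σ.emit ch ((List.range i).map (σ.reg r).testBit)).push (σ.reg r / 2 ^ i))
    (by simp) hn fun i _ k => (runs_shiftOut ch ((Nat.div_le_self _ _).trans hr)).of_eq ?_
  · exact .letIn (evals_addTo hr) (by simpa using hfor)
  · have hbit : (σ.reg r / 2 ^ i).testBit 0 = (σ.reg r).testBit i := by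
      simp [Nat.testBit_eq_decide_div_mod_eq]
    simp [hbit, List.range_succ, Nat.div_div_eq_div_mul, pow_succ]

def putSep : CounterProg R := op (.write none (some .sep))

theorem runs_putSep : putSep.Runs E σ (σ.tell [.sep]) :=
  (runs_write _ _).of_eq (by simp [CounterState.write, CounterState.tell])

theorem bits_eq_cons {n : ℕ} (hn : n ≠ 0) : n.bits = n.testBit 0 :: (n / 2).bits := by
  conv_lhs => rw [← Nat.bit_testBit_zero_shiftRight_one n]
  rw [Nat.bits_append_bit, Nat.shiftRight_one]
  intro h
  obtain rfl : n = 1 := by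
    rw [Nat.shiftRight_one] at h
    omega
  rfl

theorem runs_loop_shiftOut {n : ℕ} (hn : n ≤ E.bound) :
    (loop (.pos none) (seq (inc none) (shiftOut .oracle none))).Runs E (σ.push n)
      ((σ.emit .oracle n.bits).push 0) := by
  induction n using Nat.strong_induction_on generalizing σ with
  | _ n ih =>
    rcases Nat.eq_zero_or_pos n with rfl | hpos
    · exact (Runs.loop_done rfl).of_eq (by simp [CounterTest.after])
    · have hrec := ih (n / 2) (by omega) (σ := σ.emit .oracle [n.testBit 0]) (by omega)
      rw [CounterState.emit_emit, List.singleton_append, ← bits_eq_cons hpos.ne'] at hrec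
      have hinc : (inc none).Runs E (σ.push (n - 1)) (σ.push n) :=
        (runs_inc (by grind)).of_eq (by simp [Nat.sub_add_cancel hpos])
      have hshift : (shiftOut .oracle none).Runs E (σ.push n)
          ((σ.emit .oracle [n.testBit 0]).push (n / 2)) :=
        (runs_shiftOut .oracle hn).of_eq (by simp)
      refine .loop_step (by simp [CounterTest.holds, hpos]) (.seq ?_ hshift) hrec
      simpa [CounterTest.after] using hinc

def putNat (r : R) : CounterProg R :=
  letIn (addTo (some r) none)
    (seq (loop (.pos none) (seq (inc none) (shiftOut .oracle none))) putSep)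

theorem runs_putNat {r : R} (hr : σ.reg r ≤ E.bound) :
    (putNat r).Runs E σ (σ.tell (encodeNat (σ.reg r))) :=
  Runs.letIn (k := 0) (evals_addTo hr) (.seq (runs_loop_shiftOut hr) (runs_putSep.of_eq
    (by simp [CounterState.emit, encodeNat])))

end CounterProg

/-! ### Reading the input -/

namespace CounterState

variable {R : Type} (σ : CounterState R)

def seek (p : ℕ) : CounterState R := { σ with inputHead := p }

@[simp]
theorem seek_push (n p : ℕ) : (σ.push n).seek p = (σ.seek p).push n := rfl

@[simp]
theorem inputHead_seek (p : ℕ) : (σ.seek p).inputHead = p := rfl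

end CounterState

/-- Does the input head scan a bit? -/
def isBit : InputSym → Bool
  | .sym (.bit _) => true
  | _ => false

/-- Does the input head scan the bit `1`? -/
def isOne : InputSym → Bool
  | .sym (.bit true) => true
  | _ => false

/-- Is the input head away from the left end? -/
def notLeftEnd : InputSym → Bool
  | .leftEnd => false
  | _ => true

theorem notLeftEnd_scan_succ (inp : List TapeSym) (p : ℕ) :
    notLeftEnd (LLMachine.scan inp (p + 1)) = true := by
  simp only [LLMachine.scan]
  split <;> rfl

theorem scan_append_cons (A : List TapeSym) (a : TapeSym) (B : List TapeSym) :
    LLMachine.scan (A ++ a :: B) (A.length + 1) = .sym a := by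
  simp [LLMachine.scan]

theorem le_length_of_scan_eq_sym {inp : List TapeSym} {p : ℕ} {a : TapeSym}
    (h : LLMachine.scan inp p = .sym a) : p ≤ inp.length := by
  rcases p with _ | p
  · exact Nat.zero_le _
  · by_contra! hp
    simp [LLMachine.scan, List.getElem?_eq_none (Nat.lt_succ_iff.1 hp)] at h

/-- From position `p` on, the input consists of the bits `l`, followed by something that is not a
bit. -/
def Spells (inp : List TapeSym) : ℕ → List Bool → Prop
  | p, [] => isBit (LLMachine.scan inp p) = false
  | p, b :: l => LLMachine.scan inp p = .sym (.bit b) ∧ Spells inp (p + 1) l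

theorem spells_append (A : List TapeSym) (l : List Bool) {B : List TapeSym}
    (hB : B = [] ∨ ∃ C, B = .sep :: C) :
    Spells (A ++ (l.map .bit ++ B)) (A.length + 1) l := by
  induction l generalizing A with
  | nil =>
    rcases hB with rfl | ⟨C, rfl⟩
    · simp [Spells, LLMachine.scan, isBit]
    · simp [Spells, scan_append_cons, isBit]
  | cons b l ih =>
    refine ⟨scan_append_cons .., ?_⟩
    have hrest := ih (A ++ [.bit b])
    rwa [List.append_assoc, List.length_append] at hrest

theorem binVal_bits (n : ℕ) : binVal n.bits = n := by
  conv_rhs => rw [← Nat.ofDigits_digits 2 n, Nat.digits_two_eq_bits]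
  rw [binVal]
  congr 2

theorem binVal_lt (l : List Bool) : binVal l < 2 ^ l.length := by
  have h := Nat.ofDigits_lt_base_pow_length (l := l.map Bool.toNat) one_lt_two
    (by simp only [List.mem_map]; rintro _ ⟨b, _, rfl⟩; exact b.toNat_lt)
  simpa [binVal] using h

theorem two_pow_length_bits_le (n : ℕ) : 2 ^ n.bits.length ≤ 2 * n + 1 := by
  rw [Nat.size_eq_bits_len]
  rcases h : n.size with _ | k
  · simp
  · have hk : 2 ^ k ≤ n := Nat.lt_size.1 (h ▸ k.lt_succ_self)
    rw [pow_succ]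
    omega

namespace CounterProg

variable {R : Type} {E : RunEnv} {σ τ : CounterState R}

def moveRight : CounterProg R := op (.move .right)

theorem runs_moveRight {p : ℕ} (h : p ≤ E.input.length) :
    moveRight.Runs E (σ.seek p) (σ.seek (p + 1)) :=
  .op (Nat.succ_le_succ h)

def rewind : CounterProg R := loop (.look notLeftEnd) (op (.move .left))

theorem runs_rewind {p : ℕ} (hp : p ≤ E.input.length + 1) :
    rewind.Runs E (σ.seek p) (σ.seek 0) := by
  induction p with
  | zero => exact .loop_done rfl
  | succ p ih =>
    have hleft : (CounterOp.move .left).Legal E (σ.seek (p + 1)) := Nat.le_of_succ_le hp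
    exact .loop_step (notLeftEnd_scan_succ ..) (.op hleft) (ih (Nat.le_of_succ_le hp))

def skipBits : CounterProg R := loop (.look isBit) moveRight

theorem runs_skipBits {p : ℕ} {l : List Bool} (h : Spells E.input p l) :
    skipBits.Runs E (σ.seek p) (σ.seek (p + l.length)) := by
  induction l generalizing p with
  | nil => exact .loop_done h
  | cons b l ih =>
    have hbit : (CounterTest.look isBit).holds E (σ.seek p) = true := by
      simp [CounterTest.holds, h.1, isBit]
    exact .loop_step hbit (runs_moveRight (le_length_of_scan_eq_sym h.1))
      ((ih h.2).of_eq (by simp [add_comm, add_left_comm]))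

def skipFields : CounterProg (Option R) := loop (.pos none) (seq skipBits moveRight)

theorem runs_skipFields {A : List TapeSym} (L : List ℕ) {B : List TapeSym}
    (hE : E.input = A ++ (L.flatMap encodeNat ++ B)) :
    skipFields.Runs E ((σ.seek (A.length + 1)).push L.length)
      ((σ.seek (A.length + (L.flatMap encodeNat).length + 1)).push 0) := by
  induction L generalizing A with
  | nil => exact (Runs.loop_done (t := .pos none) rfl).of_eq (by simp [CounterTest.after])
  | cons n L ih =>
    have hn : E.input = A ++ (n.bits.map .bit ++ (.sep :: (L.flatMap encodeNat ++ B))) := by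
      simp [hE, encodeNat]
    have hbits : Spells E.input (A.length + 1) n.bits := hn ▸ spells_append A _ (.inr ⟨_, rfl⟩)
    have hlen : A.length + 1 + n.bits.length ≤ E.input.length := by
      simp only [hn, List.length_append, List.length_map, List.length_cons]
      omega
    have hrec := ih (A := A ++ encodeNat n) (by simpa using hE)
    refine .loop_step (by simp [CounterTest.holds]) (.seq (τ := ((σ.push L.length).seek _))
      (by simpa [CounterTest.after] using runs_skipBits (σ := σ.push L.length) hbits)
      (runs_moveRight hlen)) ?_
    simpa [skipFields, encodeNat, add_assoc, add_comm, add_left_comm] using hrec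

def addBit (t : CounterTest R) (p v : R) : CounterProg R :=
  seq (branch t (addTo p v) skip) (double p)

theorem runs_addBit {t : CounterTest R} {p v : R} {b : Bool} (hpv : p ≠ v)
    (hb : t.holds E σ = b) (ht : t.after σ = τ) (hv : τ.reg v + τ.reg p * b.toNat ≤ E.bound)
    (hp : 2 * τ.reg p ≤ E.bound) : (addBit t p v).Runs E σ
      ((τ.set v (τ.reg v + τ.reg p * b.toNat)).set p (2 * τ.reg p)) := by
  refine .seq (τ := τ.set v (τ.reg v + τ.reg p * b.toNat)) ?_
    ((runs_double (by simpa [hpv] using hp)).of_eq (by simp [hpv]))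
  cases b
  · exact .branch_false hb (runs_skip.of_eq (by simpa using ht))
  · refine .branch_true hb ?_
    rw [ht]
    exact (runs_addTo hpv (by simpa using hv)).of_eq (by simp)

def readBits : CounterProg (Option R) :=
  letIn (inc none) (loop (.look isBit) (seq (addBit (.look isOne) none (some none)) moveRight))

theorem runs_loop_addBit {l : List Bool} {p v k : ℕ} (h : Spells E.input p l)
    (hv : v + k * binVal l ≤ E.bound) (hk : k * 2 ^ l.length ≤ E.bound) :
    (loop (.look isBit) (seq (addBit (.look isOne) none (some none)) moveRight)).Runs E
      (((σ.seek p).push v).push k)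
      (((σ.seek (p + l.length)).push (v + k * binVal l)).push (k * 2 ^ l.length)) := by
  induction l generalizing p v k with
  | nil =>
    have hend : (CounterTest.look isBit).holds E (((σ.seek p).push v).push k) = false := h
    exact (Runs.loop_done hend).of_eq (by simp [CounterTest.after, binVal])
  | cons b l ih =>
    rw [binVal_cons] at hv
    have hbit : (CounterTest.look isBit).holds E (((σ.seek p).push v).push k) = true := by
      simp [CounterTest.holds, h.1, isBit]
    have hone : (CounterTest.look isOne).holds E (((σ.seek p).push v).push k) = b := by
      cases b <;> simp [CounterTest.holds, h.1, isOne]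
    have hv' : v + k * b.toNat + 2 * k * binVal l ≤ E.bound := by linarith
    have hk' : 2 * k * 2 ^ l.length ≤ E.bound := by
      rwa [List.length_cons, pow_succ', ← mul_assoc, mul_comm k] at hk
    have h2k : 2 * k ≤ 2 * k * 2 ^ l.length := Nat.le_mul_of_pos_right _ (by positivity)
    have hadd := runs_addBit (p := none) (v := some none) (by simp) hone rfl
      ((Nat.le_add_right _ _).trans hv') (h2k.trans hk')
    refine .loop_step hbit (.seq (hadd.of_eq (by simp [CounterTest.after]))
      (runs_moveRight (σ := (σ.push (v + k * b.toNat)).push (2 * k))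
        (le_length_of_scan_eq_sym h.1))) ((ih h.2 hv' hk').of_eq ?_)
    rw [List.length_cons, binVal_cons, pow_succ']
    ring_nf

theorem evals_readBits {p : ℕ} {l : List Bool} (h : Spells E.input p l)
    (hl : 2 ^ l.length ≤ E.bound) :
    readBits.Runs E ((σ.seek p).push 0) ((σ.seek (p + l.length)).push (binVal l)) := by
  have hone : (inc none).Runs E (((σ.seek p).push 0).push 0) (((σ.seek p).push 0).push 1) :=
    (runs_inc (r := none) (σ := (_ : CounterState _).push 0) (Nat.one_le_two_pow.trans hl)).of_eq
      (by simp)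
  refine .letIn (k := 2 ^ l.length) hone
    ((runs_loop_addBit h ?_ (by simpa using hl)).of_eq (by simp))
  simpa using (binVal_lt l).le.trans hl

def readField (e : CounterProg (Option R)) : CounterProg (Option R) :=
  seq e (seq moveRight (seq skipFields (seq readBits rewind)))

theorem evals_readField_bits {e : CounterProg (Option R)} {L : List ℕ} {l : List Bool}
    {B : List TapeSym} (hE : E.input = L.flatMap encodeNat ++ (l.map .bit ++ B))
    (hB : B = [] ∨ ∃ C, B = .sep :: C) (hσ : σ.inputHead = 0) (he : e.Evals E σ L.length)
    (hl : 2 ^ l.length ≤ E.bound) : (readField e).Evals E σ (binVal l) := by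
  have hseek : σ.seek 0 = σ := by rw [← hσ]; rfl
  have hbits := hE ▸ spells_append (L.flatMap encodeNat) l hB
  rw [← hseek] at he ⊢
  refine .seq he (.seq (runs_moveRight (σ := σ.push L.length) (Nat.zero_le _)) (.seq ?_
    (.seq (evals_readBits hbits hl) (runs_rewind (σ := σ.push _) ?_))))
  · simpa using runs_skipFields (A := []) L hE
  · simp only [hE, List.length_append, List.length_map, CounterState.inputHead_seek]
    omega

theorem evals_readField {e : CounterProg (Option R)} {L : List ℕ} {j n : ℕ} (hn : L[j]? = some n)
    {B : List TapeSym} (hE : E.input = L.flatMap encodeNat ++ B) (hσ : σ.inputHead = 0)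
    (he : e.Evals E σ j) (hb : 2 * n + 1 ≤ E.bound) : (readField e).Evals E σ n := by
  obtain ⟨hj, rfl⟩ := List.getElem?_eq_some_iff.1 hn
  have hsplit : E.input = (L.take j).flatMap encodeNat ++
      (L[j].bits.map .bit ++ (.sep :: ((L.drop (j + 1)).flatMap encodeNat ++ B))) := by
    rw [hE]
    conv_lhs => rw [← List.take_append_drop j L, List.drop_eq_getElem_cons hj]
    simp only [List.flatMap_append, List.flatMap_cons, encodeNat, List.append_assoc,
      List.nil_append, List.cons_append]
  have hread := evals_readField_bits (e := e) hsplit (.inr ⟨_, rfl⟩) hσ (by simpa [hj.le] using he)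
    ((two_pow_length_bits_le _).trans hb)
  rwa [binVal_bits] at hread

end CounterProg

/-! ### The input and the queries -/

theorem finRange_mul (a b : ℕ) : List.finRange (a * b) =
    (List.finRange a).flatMap fun i => (List.finRange b).map fun j => finProdFinEquiv (i, j) := by
  have h := List.ofFn_mul (fun i : Fin (a * b) => i)
  simp only [List.ofFn_eq_map, List.map_id_fun', id_eq] at h
  rw [h, List.flatMap_def]
  congr! 5 with i _ j
  exact Fin.ext (by simp [finProdFinEquiv, add_comm, mul_comm])

theorem ofFn_bitStringOfNat (d k : ℕ) :
    List.ofFn (bitStringOfNat d k) = (List.range d).map k.testBit := by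
  rw [← List.map_coe_finRange_eq_range, List.map_map, List.ofFn_eq_map]
  rfl

namespace Automaton

variable {w d m : ℕ} (Q : Automaton w d)

/-- The entries of the transition table of an automaton, in the order of `encodeAutomaton`. -/
def table : List ℕ :=
  List.ofFn fun i : Fin (w * 2 ^ d) =>
    (Q (finProdFinEquiv.symm i).1 (bitStringOfNat d (finProdFinEquiv.symm i).2) : ℕ)

theorem encodeAutomaton_eq_flatMap_table : encodeAutomaton Q = Q.table.flatMap encodeNat := by
  rw [table, List.ofFn_eq_map, finRange_mul, encodeAutomaton]
  simp only [← List.map_coe_finRange_eq_range, List.flatMap_map, List.flatMap_assoc,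
    Equiv.symm_apply_apply]

theorem table_getElem? (u : Fin w) {z : ℕ} (hz : z < 2 ^ d) :
    Q.table[u * 2 ^ d + z]? = some (Q u (bitStringOfNat d z) : ℕ) := by
  have hindex : u * 2 ^ d + z = (finProdFinEquiv (u, (⟨z, hz⟩ : Fin (2 ^ d))) : ℕ) := by
    simp [finProdFinEquiv, add_comm, mul_comm]
  simp only [table, hindex, List.getElem?_ofFn, Fin.is_lt, dite_true, Fin.eta,
    Equiv.symm_apply_apply]

theorem encodeAutomaton_layered (moving : Bool) :
    encodeAutomaton (Q.layered (m := m) moving) = (List.finRange w).flatMap fun u =>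
      (List.finRange m).flatMap fun l => (List.finRange (2 ^ d)).flatMap fun z : Fin (2 ^ d) =>
        encodeNat (Q.layered moving (finProdFinEquiv (u, l)) (bitStringOfNat d z)) := by
  simp only [encodeAutomaton, finRange_mul, ← List.map_coe_finRange_eq_range, List.flatMap_map,
    List.flatMap_assoc]

end Automaton

/-- The numbers in the input of `Q`, `q` and `x`, which are followed by the bits of `x`. -/
def inputFields {w d : ℕ} (m s : ℕ) (Q : Automaton w d) (q : Fin w) : List ℕ :=
  w :: d :: m :: s :: (Q.table ++ [(q : ℕ)])

section InputFields

variable {w d m s : ℕ} {Q : Automaton w d} {q : Fin w}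

theorem encodeInput_eq (x : BitString s) : encodeInput m Q q x =
    (inputFields m s Q q).flatMap encodeNat ++ ((List.ofFn x).map .bit ++ []) := by
  simp [encodeInput, encodeInstance, inputFields, Q.encodeAutomaton_eq_flatMap_table]

theorem length_inputFields : (inputFields m s Q q).length = 5 + w * 2 ^ d := by
  simp only [inputFields, Automaton.table, List.length_cons, List.length_append, List.length_ofFn,
    List.length_nil]
  omega

theorem inputFields_getElem?_table (u : Fin w) {z : ℕ} (hz : z < 2 ^ d) :
    (inputFields m s Q q)[4 + (u * 2 ^ d + z)]? = some (Q u (bitStringOfNat d z) : ℕ) := by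
  have h := Q.table_getElem? u hz
  rw [add_comm, inputFields]
  simp only [List.getElem?_cons_succ]
  rwa [List.getElem?_append_left (List.getElem?_eq_some_iff.1 h).1]

theorem inputFields_getElem?_state :
    (inputFields m s Q q)[4 + w * 2 ^ d]? = some (q : ℕ) := by
  rw [add_comm, inputFields]
  simp [Automaton.table]

end InputFields

/-! ### Tables and queries -/

/-- The numbers that the generator keeps in counters throughout: the parameters `w`, `d`, `m`, `s`,
and the numbers `2 ^ d` of blocks and `2 ^ s` of seeds. -/
inductive Param : Type
  | w | d | m | s | blocks | seeds

namespace Param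

def value (w d m s : ℕ) : Param → ℕ
  | .w => w
  | .d => d
  | .m => m
  | .s => s
  | .blocks => 2 ^ d
  | .seeds => 2 ^ s

instance : Finite Param :=
  Set.finite_univ_iff.1 ((Set.toFinite {w, d, m, s, blocks, seeds}).subset fun p _ => by
    cases p <;> simp)

end Param

/-- The input consists of the instance `Q`, `q`, `x`, and the bound on the counters is large enough
for the generator. -/
structure RunEnv.HasInstance (E : RunEnv) {w d s : ℕ} (m : ℕ) (Q : Automaton w d) (q : Fin w)
    (x : BitString s) : Prop where
  input_eq : E.input = encodeInput m Q q x
  le_bound : 8 * ((w + 1) * (m + 1)) * (2 ^ d * 2 ^ s) ≤ E.bound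

namespace RunEnv.HasInstance

variable {E : RunEnv} {w d m s : ℕ} {Q : Automaton w d} {q : Fin w} {x : BitString s}
  (hE : E.HasInstance m Q q x)
include hE

theorem eight_mul_le {a b : ℕ} (ha : a ≤ (w + 1) * (m + 1)) (hb : b ≤ 2 ^ d * 2 ^ s) :
    8 * (a * b) ≤ E.bound := by
  refine le_trans ?_ hE.le_bound
  rw [mul_assoc]
  gcongr

theorem states_mul_layers_le : 8 * (w * m + 1) ≤ E.bound := by
  have hstates : w * m + 1 ≤ (w + 1) * (m + 1) := by nlinarith
  simpa using hE.eight_mul_le hstates (Nat.mul_pos (Nat.two_pow_pos d) (Nat.two_pow_pos s))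

theorem states_mul_blocks_le : 8 * ((w + 1) * 2 ^ d) ≤ E.bound :=
  hE.eight_mul_le (Nat.le_mul_of_pos_right _ m.succ_pos)
    (Nat.le_mul_of_pos_right _ (Nat.two_pow_pos s))

theorem eight_mul_value_le (p : Param) : 8 * p.value w d m s ≤ E.bound := by
  have hd : d ≤ 2 ^ d := d.lt_two_pow_self.le
  have hs : s ≤ 2 ^ s := s.lt_two_pow_self.le
  have hwm : 1 ≤ (w + 1) * (m + 1) := Nat.mul_pos w.succ_pos m.succ_pos
  have hds : 1 ≤ 2 ^ d * 2 ^ s := Nat.mul_pos (Nat.two_pow_pos d) (Nat.two_pow_pos s)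
  have hblocks : 2 ^ d ≤ 2 ^ d * 2 ^ s := Nat.le_mul_of_pos_right _ (Nat.two_pow_pos s)
  have hseeds : 2 ^ s ≤ 2 ^ d * 2 ^ s := Nat.le_mul_of_pos_left _ (Nat.two_pow_pos d)
  suffices h : p.value w d m s ≤ (w + 1) * (m + 1) ∨ p.value w d m s ≤ 2 ^ d * 2 ^ s by
    rcases h with h | h
    · simpa using hE.eight_mul_le h hds
    · simpa using hE.eight_mul_le hwm h
  cases p <;> simp only [Param.value]
  · exact .inl (by nlinarith)
  · exact .inr (hd.trans hblocks)
  · exact .inl (by nlinarith)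
  · exact .inr (hs.trans hseeds)
  · exact .inr hblocks
  · exact .inr hseeds

theorem value_le (p : Param) : p.value w d m s ≤ E.bound :=
  (Nat.le_mul_of_pos_left _ (by norm_num)).trans (hE.eight_mul_value_le p)

end RunEnv.HasInstance

/-- The counters `ι` hold the parameters, and the input head is at the left end. -/
structure CounterState.Loaded {R : Type} (σ : CounterState R) (w d m s : ℕ) (ι : Param → R) :
    Prop where
  reg_eq : ∀ p, σ.reg (ι p) = p.value w d m s
  inputHead_eq : σ.inputHead = 0

namespace CounterState.Loaded

variable {R : Type} {σ : CounterState R} {w d m s : ℕ} {ι : Param → R} (h : σ.Loaded w d m s ι)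
include h

theorem push (n : ℕ) : (σ.push n).Loaded w d m s fun p => some (ι p) := ⟨h.reg_eq, h.inputHead_eq⟩

theorem tell (l : List TapeSym) : (σ.tell l).Loaded w d m s ι := ⟨h.reg_eq, h.inputHead_eq⟩

theorem emit_output (l : List Bool) : (σ.emit .output l).Loaded w d m s ι :=
  ⟨h.reg_eq, h.inputHead_eq⟩

theorem set {r : R} (hr : ∀ p, ι p ≠ r) (n : ℕ) : (σ.set r n).Loaded w d m s ι :=
  ⟨fun p => (σ.reg_set_of_ne (hr p) n).trans (h.reg_eq p), h.inputHead_eq⟩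

end CounterState.Loaded

namespace CounterProg

variable {R : Type} {E : RunEnv} {σ : CounterState R} {w d m s : ℕ}

theorem runs_forLt_tell {r : R} {A : CounterProg (Option (Option R))} {n : ℕ}
    (F : Fin n → List TapeSym) (hr : σ.reg r = n) (hn : n ≤ E.bound)
    (hA : ∀ (i : Fin n) (k : ℕ) (l : List TapeSym), A.Runs E (((σ.tell l).push k).push i)
      ((((σ.tell l).push k).push i).tell (F i))) :
    (forLt r A).Runs E σ (σ.tell ((List.finRange n).flatMap F)) := by
  have hfor := runs_forLt (E := E) (r := r) (A := A)
    (fun i => σ.tell (((List.finRange n).take i).flatMap F)) (by simpa using hr) hn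
    fun i hi k => (hA ⟨i, hi⟩ k _).of_eq ?_
  · simpa [List.take_of_length_le] using hfor
  · simp [List.take_add_one, hi]

variable (ι : Param → R)

/-- The expression for the next state of `Q` after reading the block number `z` in the state `u`,
which is looked up in the input. -/
def lookup (u z : R) : CounterProg (Option R) :=
  readField (seq (const 4) (seq (mulAddTo (some u) (some (ι .blocks)) none) (addTo (some z) none)))

def layeredNextState (moving : Bool) (u l z : R) : CounterProg (Option R) :=
  branch (.pos (some l)) (lookup ι u z) (bif moving then lookup ι u z else addTo (some u) none)

/-- The expression for the next state of the layered automaton after reading the block number `z` in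
the state `u` in the layer `l`: it is `u' * m + l'`, where `u'` is the next state of `Q` and `l'` is
the next layer. -/
def layeredNext (moving : Bool) (u l z : R) : CounterProg (Option R) :=
  letIn (addTo (some (some l)) none) (seq
    (letIn
      (layeredNextState (fun p => some (some (ι p))) moving (some (some u)) none (some (some z)))
      (mulAddTo none (some (some (some (ι .m)))) (some (some none))))
    (addTo none (some none)))

def putEntry (moving : Bool) (u l z : R) : CounterProg R :=
  letIn (layeredNext ι moving u l z) (putNat none)

/-- Writes the transition table of the layered automaton. -/
def putTable (moving : Bool) : CounterProg R :=
  forLt (ι .w) (forLt (some (some (ι .m))) (forLt (some (some (some (some (ι .blocks)))))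
    (putEntry (fun p => some (some (some (some (some (some (ι p))))))) moving
      (some (some (some (some none)))) (some (some none)) none)))

/-- Writes the query for the bit number `i` of the result of the simulator when it is started in the
state `a` of the layered automaton with the seed number `y`. -/
def putQuery (moving : Bool) (i a y : R) : CounterProg R :=
  seq (putNat i) (seq (putTable ι moving) (seq (putNat a) (putFixed .oracle (ι .s) y)))

variable {ι} {Q : Automaton w d} {q : Fin w} {x : BitString s} (hE : E.HasInstance m Q q x)
  (hσ : σ.Loaded w d m s ι)
include hE hσ

theorem evals_lookup {u z : R} {v : Fin w} (hu : σ.reg u = v) (hz : σ.reg z < 2 ^ d) :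
    (lookup ι u z).Evals E σ (Q v (bitStringOfNat d (σ.reg z))) := by
  have hB := hσ.reg_eq .blocks
  have hbound := hE.states_mul_blocks_le
  have hindex : ((v : ℕ) + 1) * 2 ^ d ≤ w * 2 ^ d := Nat.mul_le_mul_right _ v.isLt
  simp only [Param.value, add_one_mul] at hB hindex hbound
  have hw : w ≤ w * 2 ^ d := Nat.le_mul_of_pos_right _ (Nat.two_pow_pos d)
  have hnext := (Q v (bitStringOfNat d (σ.reg z))).isLt
  refine evals_readField (inputFields_getElem?_table v hz) (hE.input_eq.trans (encodeInput_eq x))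
    hσ.inputHead_eq (.seq (evals_const (n := 4) (by omega)) (.seq ((runs_mulAddTo
      (a := some u) (b := some (ι .blocks)) (c := none) (σ := σ.push 4) (Option.some_ne_none _)
      ?_ ?_).of_eq ?_) ((runs_addTo (a := some z) (b := none)
      (σ := σ.push (4 + v * 2 ^ d)) (Option.some_ne_none _) ?_).of_eq ?_))) ?_
  · simpa [hu] using v.isLt.le.trans (hE.value_le .w)
  · simpa [hu, hB] using (by omega : 4 + (v : ℕ) * 2 ^ d ≤ E.bound)
  · simp [hu, hB]
  · simpa using (by omega : 4 + (v : ℕ) * 2 ^ d + σ.reg z ≤ E.bound)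
  · simp [add_assoc]
  · omega

theorem evals_layeredNextState (moving : Bool) {u l z : R} {v : Fin w} {n : ℕ} (hul : u ≠ l)
    (hzl : z ≠ l) (hι : ∀ p, ι p ≠ l) (hu : σ.reg u = v) (hl : σ.reg l = n)
    (hz : σ.reg z < 2 ^ d) : (layeredNextState ι moving u l z).Runs E (σ.push 0)
      ((σ.set l (n - 1)).push
        (if n = 0 ∧ moving = false then v else Q v (bitStringOfNat d (σ.reg z)) : Fin w)) := by
  have hnext := evals_lookup hE (hσ.set hι (n - 1)) (u := u) (z := z) (v := v) (by simpa [hul])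
    (by simpa [hzl])
  simp only [CounterState.reg_set_of_ne _ hzl] at hnext
  have hafter : (CounterTest.pos (some l)).after (σ.push 0) = (σ.set l (n - 1)).push 0 := by
    simp [CounterTest.after, hl]
  by_cases hn : n = 0
  · refine .branch_false (by simp [CounterTest.holds, hl, hn]) ?_
    rw [hafter]
    cases moving
    · have hcopy := evals_addTo (E := E) (σ := σ.set l (n - 1)) (a := u)
        (by simpa [hul, hu] using v.isLt.le.trans (hE.value_le .w))
      simpa [Evals, hn, hul, hu] using hcopy
    · simpa [Evals] using hnext
  · refine .branch_true (by simpa [CounterTest.holds, hl] using Nat.pos_of_ne_zero hn) ?_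
    rw [hafter]
    simpa [Evals, hn] using hnext

theorem evals_layeredNext (moving : Bool) {u l z : R} {v : Fin w} {k : Fin m} (hu : σ.reg u = v)
    (hl : σ.reg l = k) (hz : σ.reg z < 2 ^ d) : (layeredNext ι moving u l z).Evals E σ
      (Q.layered moving (finProdFinEquiv (v, k)) (bitStringOfNat d (σ.reg z))) := by
  have hm := hσ.reg_eq .m
  have hbound := hE.states_mul_layers_le
  simp only [Param.value] at hm
  rw [Automaton.layered_apply]
  set v' := if (k : ℕ) = 0 ∧ moving = false then v else Q v (bitStringOfNat d (σ.reg z))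
  have hstate : (layeredNextState (fun p => some (some (ι p))) moving (some (some u)) none
      (some (some z))).Runs E (((σ.push 0).push k).push 0)
      (((σ.push 0).push (k - 1)).push v') :=
    (evals_layeredNextState hE ((hσ.push 0).push k) moving (u := some (some u)) (v := v)
      (z := some (some z)) (by simp) (by simp) (by simp) hu rfl hz).of_eq
      (by rw [CounterState.set_push_none]; rfl)
  have hindex := (finProdFinEquiv (v', (⟨k - 1, (Nat.sub_le _ _).trans_lt k.isLt⟩ : Fin m))).isLt
  simp only [finProdFinEquiv_apply_val] at hindex ⊢
  rw [add_comm, mul_comm] at hindex ⊢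
  have hpos : 0 < m := k.pos
  have hmul : (v' : ℕ) ≤ v' * m := Nat.le_mul_of_pos_right _ hpos
  have hwm : m ≤ w * m := Nat.le_mul_of_pos_left _ v.pos
  refine .letIn (n := k) (k := k - 1) ?_ (.seq (τ := (σ.push (v' * m)).push (k - 1))
    (.letIn (k := v') hstate ((runs_mulAddTo (by simp) ?_ ?_).of_eq ?_))
    ((runs_addTo (by simp) ?_).of_eq ?_))
  · exact (evals_addTo (by grind)).of_eq (by simp [hl])
  · simpa using (by omega : (v' : ℕ) ≤ E.bound)
  · simpa [hm] using (by omega : (v' : ℕ) * m ≤ E.bound)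
  · simp [hm]
  · simpa using (by omega : (v' : ℕ) * m + (k - 1) ≤ E.bound)
  · simp

theorem runs_putEntry (moving : Bool) {u l z : R} {v : Fin w} {k : Fin m} (hu : σ.reg u = v)
    (hl : σ.reg l = k) (hz : σ.reg z < 2 ^ d) : (putEntry ι moving u l z).Runs E σ (σ.tell
      (encodeNat (Q.layered moving (finProdFinEquiv (v, k)) (bitStringOfNat d (σ.reg z))))) := by
  have hbound := hE.states_mul_layers_le
  have hnext := Fin.is_lt (Q.layered moving (finProdFinEquiv (v, k)) (bitStringOfNat d (σ.reg z)))
  exact .letIn (evals_layeredNext hE hσ moving hu hl hz) ((runs_putNat (by grind)).of_eq rfl)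

theorem runs_putTable (moving : Bool) : (putTable ι moving).Runs E σ
    (σ.tell (encodeAutomaton (Q.layered (m := m) moving))) := by
  rw [Q.encodeAutomaton_layered]
  exact runs_forLt_tell _ (hσ.reg_eq .w) (hE.value_le .w) fun u _ _ => runs_forLt_tell _
    (hσ.reg_eq .m) (hE.value_le .m) fun l _ _ => runs_forLt_tell _ (hσ.reg_eq .blocks)
    (hE.value_le .blocks) fun z _ _ => runs_putEntry hE
    (((((((((hσ.tell _).push _).push u).tell _).push _).push l).tell _).push _).push z)
    moving (u := some (some (some (some none)))) (l := some (some none)) (z := none)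
    (v := u) (k := l) rfl rfl z.isLt

theorem runs_putQuery (moving : Bool) {i a y : R} {V : Fin (w * m)} (hi : σ.reg i ≤ E.bound)
    (ha : σ.reg a = V) (hy : σ.reg y ≤ E.bound) : (putQuery ι moving i a y).Runs E σ
      (σ.tell (encodeNat (σ.reg i) ++
        encodeInstance (Q.layered moving) V (bitStringOfNat s (σ.reg y)))) := by
  have hs := hσ.reg_eq .s
  have hbound := hE.states_mul_layers_le
  refine .seq (runs_putNat hi) (.seq (runs_putTable hE (hσ.tell _) moving) (.seq (runs_putNat ?_)
    ((runs_putFixed .oracle (σ := σ.tell _ |>.tell _ |>.tell _) ?_ hy).of_eq ?_)))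
  · simpa [ha] using (by omega : (V : ℕ) ≤ E.bound)
  · simpa [hs] using hE.value_le .s
  · simp [CounterState.emit, encodeInstance, ofFn_bitStringOfNat, hs, ha, Param.value]

end CounterProg

/-! ### Consulting the oracle -/

namespace CounterProg

variable {R : Type} {E : RunEnv} {σ : CounterState R}

def readAnswerLoop (A : CounterProg (Option (Option (Option R)))) :
    CounterProg (Option (Option (Option R))) :=
  loop (.answer Option.isSome) (seq A
    (seq (addBit (.answer (· == some true)) none (some (some none))) (seq (inc (some none)) A)))

/-- The expression for the number that the oracle returns on a certain query string, where the
program `A` writes this query string, preceded by the index in the counter `some none`. Since a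
query erases the oracle tape, every bit is asked for twice: to know whether it exists, and to get
its value. -/
def readAnswer (A : CounterProg (Option (Option (Option R)))) : CounterProg (Option R) :=
  letIn skip (letIn (inc none) (seq A (readAnswerLoop A)))

theorem holds_answer_tell (hσ : σ.oracleTape = []) (p : Option Bool → Bool) (i : ℕ)
    (u : List TapeSym) :
    (CounterTest.answer p).holds E (σ.tell (encodeNat i ++ u)) = p (E.oracle u)[i]? := by
  simp [CounterTest.holds, CounterState.tell, hσ, oracleAnswer_encodeNat]

theorem after_answer_tell (hσ : σ.oracleTape = []) (p : Option Bool → Bool) (l : List TapeSym) :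
    (CounterTest.answer p).after (σ.tell l) = σ := by
  simp [CounterTest.after, CounterState.tell, ← hσ]

variable {A : CounterProg (Option (Option (Option R)))} {u : List TapeSym}
  (hσ : σ.oracleTape = [])
  (hA : ∀ v i k, i ≤ E.bound → A.Runs E (((σ.push v).push i).push k)
    ((((σ.push v).push i).push k).tell (encodeNat i ++ u)))
include hσ hA

theorem runs_readAnswerLoop {l : List Bool} {v i k : ℕ} (hl : (E.oracle u).drop i = l)
    (hi : i + l.length ≤ E.bound) (hv : v + k * binVal l ≤ E.bound)
    (hk : k * 2 ^ l.length ≤ E.bound) : (readAnswerLoop A).Runs E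
      ((((σ.push v).push i).push k).tell (encodeNat i ++ u))
      (((σ.push (v + k * binVal l)).push (i + l.length)).push (k * 2 ^ l.length)) := by
  have htest : ∀ v i k p, (CounterTest.answer p).holds E
      ((((σ.push v).push i).push k).tell (encodeNat i ++ u)) = p (E.oracle u)[i]? :=
    fun _ i _ p => holds_answer_tell hσ p i u
  have hafter : ∀ v i k p, (CounterTest.answer p).after
      ((((σ.push v).push i).push k).tell (encodeNat i ++ u)) = ((σ.push v).push i).push k :=
    fun v i k p => after_answer_tell (σ := ((σ.push v).push i).push k) hσ p _
  induction l generalizing v i k with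
  | nil =>
    have hnone : (E.oracle u)[i]? = none := by rw [← List.head?_drop, hl, List.head?_nil]
    have hdone : (CounterTest.answer Option.isSome).holds E
        ((((σ.push v).push i).push k).tell (encodeNat i ++ u)) = false := by
      rw [htest, hnone, Option.isSome_none]
    exact (Runs.loop_done hdone).of_eq ((hafter ..).trans (by simp [binVal]))
  | cons b l ih =>
    have hhead : (E.oracle u)[i]? = some b := by rw [← List.head?_drop, hl, List.head?_cons]
    have hrest : (E.oracle u).drop (i + 1) = l := by rw [← List.tail_drop, hl, List.tail_cons]
    rw [binVal_cons] at hv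
    rw [List.length_cons] at hi
    have hv' : v + k * b.toNat + 2 * k * binVal l ≤ E.bound := by linarith
    have hk' : 2 * k * 2 ^ l.length ≤ E.bound := by
      rwa [List.length_cons, pow_succ', ← mul_assoc, mul_comm k] at hk
    have h2k : 2 * k ≤ 2 * k * 2 ^ l.length := Nat.le_mul_of_pos_right _ (by positivity)
    have hsome : (CounterTest.answer Option.isSome).holds E
        ((((σ.push v).push i).push k).tell (encodeNat i ++ u)) = true := by
      rw [htest, hhead, Option.isSome_some]
    have hbit : (CounterTest.answer (· == some true)).holds E
        ((((σ.push v).push i).push k).tell (encodeNat i ++ u)) = b := by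
      rw [htest, hhead]
      cases b <;> rfl
    have hadd := runs_addBit (p := none) (v := some (some none)) (by simp) hbit (hafter ..)
      ((Nat.le_add_right _ _).trans hv') (h2k.trans hk')
    have hinc : (inc (some none)).Runs E (((σ.push (v + k * b.toNat)).push i).push (2 * k))
        (((σ.push (v + k * b.toNat)).push (i + 1)).push (2 * k)) :=
      (runs_inc (by grind)).of_eq (by simp)
    refine .loop_step hsome (.seq ((hafter ..).symm ▸ hA v i k (by omega)) (.seq
      (hadd.of_eq (by simp)) (.seq hinc (hA _ _ _ (by omega))))) ((ih hrest (by omega) hv'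
      hk').of_eq ?_)
    rw [List.length_cons, binVal_cons, pow_succ']
    ring_nf

theorem evals_readAnswer {l : List Bool} (hl : E.oracle u = l) (hbound : 2 ^ l.length ≤ E.bound) :
    (readAnswer A).Evals E σ (binVal l) := by
  have hinc : (inc none).Runs E (((σ.push 0).push 0).push 0) (((σ.push 0).push 0).push 1) :=
    (runs_inc (r := none) (σ := (_ : CounterState _).push 0)
      (Nat.one_le_two_pow.trans hbound)).of_eq (by simp)
  have hloop := runs_readAnswerLoop hσ hA (l := l) (v := 0) (i := 0) (k := 1) hl
    (by simpa using l.length.lt_two_pow_self.le.trans hbound)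
    (by simpa using (binVal_lt l).le.trans hbound) (by simpa using hbound)
  simp only [zero_add, one_mul] at hloop
  exact .letIn runs_skip (.letIn hinc (.seq (hA _ _ _ (Nat.zero_le _)) hloop))

end CounterProg

/-! ### Greedy choices -/

namespace CounterProg

variable {R : Type} {E : RunEnv} {σ : CounterState R} {w d m s : ℕ}

def incIfEq (a b c : R) : CounterProg R :=
  ifLt a b skip (ifLt (some b) (some a) skip (inc (some (some c))))

theorem runs_incIfEq {a b c : R} (ha : σ.reg a ≤ E.bound) (hb : σ.reg b ≤ E.bound)
    (hc : σ.reg c < E.bound) :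
    (incIfEq a b c).Runs E σ (σ.set c (σ.reg c + if σ.reg a = σ.reg b then 1 else 0)) := by
  refine runs_ifLt ha hb (fun hab => runs_skip.of_eq ?_) fun hab =>
    runs_ifLt hb ha (fun hba => runs_skip.of_eq ?_) fun hba =>
      (runs_inc (r := some (some c)) hc).of_eq ?_
  · simp [hab.ne]
  · simp [(show σ.reg b < σ.reg a from hba).ne']
  · have heq : σ.reg a = σ.reg b := le_antisymm (not_lt.1 hba) (not_lt.1 hab)
    simp [heq]

def assign (r : R) (e : CounterProg (Option R)) : CounterProg R :=
  letIn e (seq (clear (some r)) (addTo none (some r)))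

theorem runs_assign {r : R} {e : CounterProg (Option R)} {n : ℕ} (he : e.Evals E σ n)
    (hn : n ≤ E.bound) : (assign r e).Runs E σ (σ.set r n) :=
  .letIn (k := n) he (.seq (runs_clear _) ((runs_addTo (by simp) (by simpa)).of_eq (by simp)))

def assignIfLt (a b x y : R) : CounterProg R :=
  ifLt a b (assign (some x) (addTo (some (some y)) none)) skip

theorem runs_assignIfLt {a b x y : R} (ha : σ.reg a ≤ E.bound) (hb : σ.reg b ≤ E.bound)
    (hy : σ.reg y ≤ E.bound) : (assignIfLt a b x y).Runs E σ
      (σ.set x (if σ.reg a < σ.reg b then σ.reg y else σ.reg x)) := by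
  refine runs_ifLt ha hb (fun hlt => (runs_assign (evals_addTo (a := some y) hy) hy).of_eq ?_)
    fun hle => runs_skip.of_eq ?_
  · simp [hlt]
  · simp [hle]

variable (ι : Param → R)

/-- The expression for the result of the simulator when it is started in the state `a` of the
layered automaton with the seed number `y`. -/
def askSim (moving : Bool) (a y : R) : CounterProg (Option R) :=
  readAnswer (putQuery (fun p => some (some (some (ι p)))) moving (some none)
    (some (some (some a))) (some (some (some y))))

def addHits (V a c : R) : CounterProg R :=
  forLt (ι .seeds) (letIn (askSim (fun p => some (some (ι p))) false (some (some a)) none)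
    (incIfEq none (some (some (some V))) (some (some (some c)))))

/-- The expression for the number of the copy of the state `u` in the layer `l`. -/
def layerCopy (u l : R) : CounterProg (Option R) :=
  seq (mulAddTo (some u) (some (ι .m)) none) (addTo (some l) none)

/-- The expression for the number of seeds on which the simulator gets to `V` when it is started in
the layer `l` of the frozen layered automaton, at the state of `Q` that follows `u` after reading
the block number `z`. -/
def scoreNext (V l u z : R) : CounterProg (Option R) :=
  letIn (lookup (fun p => some (ι p)) (some u) (some z))
    (letIn (layerCopy (fun p => some (ι p)) none (some l))
      (addHits (fun p => some (some (some (ι p)))) (some (some (some V))) none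
        (some (some none))))

/-- The expression for the number of a block that leads from `u` to a state of maximal score. -/
def chooseBlock (V l u : R) : CounterProg (Option R) :=
  forLt (some (ι .blocks)) (letIn
    (scoreNext (fun p => some (some (some (ι p)))) (some (some (some V))) (some (some (some l)))
      (some (some (some u))) (some (some none)))
    (letIn
      (scoreNext (fun p => some (some (some (some (ι p))))) (some (some (some (some V))))
        (some (some (some (some l)))) (some (some (some (some u)))) (some none))
      (assignIfLt (some none) none (some (some (some (some none)))) (some (some none)))))

variable {ι} {Q : Automaton w d} {q : Fin w} {x : BitString s} (hE : E.HasInstance m Q q x)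
  {Sim : Automaton (w * m) d × Fin (w * m) → BitString s → Fin (w * m)}
  (hSim : IsOracleFor E.oracle Sim) (hσ : σ.Loaded w d m s ι) (hσ' : σ.oracleTape = [])
include hE hσ

theorem evals_layerCopy {u l : R} {v : Fin w} {k : Fin m} (hu : σ.reg u = v) (hl : σ.reg l = k) :
    (layerCopy ι u l).Evals E σ (finProdFinEquiv (v, k)) := by
  have hm := hσ.reg_eq .m
  have hbound := hE.states_mul_layers_le
  have hindex := (finProdFinEquiv (v, k)).isLt
  have hv : (v : ℕ) ≤ v * m := Nat.le_mul_of_pos_right _ k.pos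
  simp only [finProdFinEquiv_apply_val, Param.value] at hm hindex ⊢
  rw [add_comm, mul_comm] at hindex ⊢
  refine .seq (τ := σ.push (v * m)) ((runs_mulAddTo (by simp) ?_ ?_).of_eq ?_)
    ((runs_addTo (by simp) ?_).of_eq ?_)
  · simpa [hu] using (by omega : (v : ℕ) ≤ E.bound)
  · simpa [hu, hm] using (by omega : (v : ℕ) * m ≤ E.bound)
  · simp [hu, hm]
  · simpa [hl] using (by omega : (v : ℕ) * m + k ≤ E.bound)
  · simp [hl]

include hSim hσ'

theorem evals_askSim (moving : Bool) {a y : R} {V : Fin (w * m)} (ha : σ.reg a = V)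
    (hy : σ.reg y ≤ E.bound) : (askSim ι moving a y).Evals E σ
      (Sim (Q.layered moving, V) (bitStringOfNat s (σ.reg y))) := by
  have hbound := hE.states_mul_layers_le
  have hlt := (Sim (Q.layered moving, V) (bitStringOfNat s (σ.reg y))).isLt
  have hread := evals_readAnswer hσ' (u := encodeInstance (Q.layered moving) V
    (bitStringOfNat s (σ.reg y))) (fun v i k hi => runs_putQuery hE (((hσ.push v).push i).push k)
      moving (i := some none) (a := some (some (some a))) (y := some (some (some y))) hi ha hy)
    (hSim _ _ _)
    ((two_pow_length_bits_le _).trans (by grind))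
  rwa [binVal_bits] at hread

theorem runs_addHits {V a c : R} (hι : ∀ p, ι p ≠ c) (hVc : V ≠ c) (hac : a ≠ c) {t : Fin (w * m)}
    (hV : σ.reg V = t) {u : Fin w} {l : Fin m} (ha : σ.reg a = finProdFinEquiv (u, l)) :
    (addHits ι V a c).Runs E (σ.set c 0) (σ.set c (hitCount Sim Q t l u)) := by
  have hbound := hE.states_mul_layers_le
  have hseeds : (2 ^ s : ℕ) ≤ E.bound := hE.value_le .seeds
  let result (y : ℕ) := Sim (Q.layered false, finProdFinEquiv (u, l)) (bitStringOfNat s y)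
  have hcount : hitCount Sim Q t l u = Nat.count (fun y => result y = t) (2 ^ s) := by
    simp [hitCount, result]
  rw [hcount]
  refine runs_forLt (fun i => σ.set c (Nat.count (fun y => result y = t) i))
    ((hσ.set hι _).reg_eq .seeds) hseeds fun i hi k => ?_
  have hle := Nat.count_le (p := fun y => result y = t) (n := i)
  have hlt := (result i).isLt
  refine .letIn (k := result i) (evals_askSim hE hSim (((hσ.set hι _).push k).push i) hσ' false
    (V := finProdFinEquiv (u, l)) (by simpa [hac] using ha) (y := none) (by grind))
    ((runs_incIfEq (by grind) (by grind) (by grind)).of_eq ?_)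
  simp [Nat.count_succ, hV, hVc, Fin.ext_iff, result]

theorem evals_scoreNext {V l u z : R} {t : Fin (w * m)} (hV : σ.reg V = t) {k : Fin m}
    (hl : σ.reg l = k) {v : Fin w} (hu : σ.reg u = v) (hz : σ.reg z < 2 ^ d) :
    (scoreNext ι V l u z).Evals E σ
      (hitCount Sim Q t k (Q v (bitStringOfNat d (σ.reg z)))) := by
  let v' := Q v (bitStringOfNat d (σ.reg z))
  have hhits := runs_addHits (V := some (some (some V))) (a := none) (c := some (some none)) hE hSim
    (((hσ.push 0).push v').push (finProdFinEquiv (v', k) : Fin (w * m))) hσ' (by simp) (by simp)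
    (by simp) hV (u := v') (l := k) rfl
  exact .letIn (evals_lookup hE (hσ.push 0) hu hz)
    (.letIn (evals_layerCopy hE ((hσ.push 0).push v') rfl hl) (by simpa using hhits))

theorem evals_chooseBlock {V l u : R} {t : Fin (w * m)} (hV : σ.reg V = t) {k : Fin m}
    (hl : σ.reg l = k) {v : Fin w} (hu : σ.reg u = v) :
    (chooseBlock ι V l u).Evals E σ (Q.greedyBlock (hitCount Sim Q t) k v) := by
  have hblocks : (2 ^ d : ℕ) ≤ E.bound := hE.value_le .blocks
  have hseeds : (2 ^ s : ℕ) ≤ E.bound := hE.value_le .seeds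
  let score (z : ℕ) := hitCount Sim Q t k (Q v (bitStringOfNat d z))
  have hscore (z : ℕ) : score z ≤ E.bound := (Nat.count_le _).trans hseeds
  refine runs_forLt (fun i => σ.push (argmaxBelow score i)) (hσ.reg_eq .blocks) hblocks
    fun i hi j => ?_
  have hbest : argmaxBelow score i < 2 ^ d := by
    rcases i.eq_zero_or_pos with rfl | hpos
    · exact Nat.two_pow_pos d
    · exact (argmaxBelow_lt score hpos).trans hi
  refine .letIn (k := score (argmaxBelow score i)) (evals_scoreNext hE hSim
    (((hσ.push _).push j).push i) hσ' (V := some (some (some V))) (l := some (some (some l)))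
    (u := some (some (some u))) (z := some (some none)) hV hl hu hbest)
    (.letIn (k := score i) (evals_scoreNext hE hSim ((((hσ.push _).push j).push i).push _) hσ'
      (V := some (some (some (some V)))) (l := some (some (some (some l))))
      (u := some (some (some (some u)))) (z := some none) hV hl hu hi)
      ((runs_assignIfLt (hscore _) (hscore _) (hi.le.trans hblocks)).of_eq ?_))
  simp only [CounterState.set_push_some, CounterState.set_push_none]
  rfl

end CounterProg

/-! ### The generator -/

theorem binVal_ofFn {n : ℕ} (f : Fin n → Bool) : binVal (List.ofFn f) = Nat.ofBits f := by
  induction n with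
  | zero => rfl
  | succ n ih =>
    rw [List.ofFn_succ, binVal_cons, ih, Nat.ofBits_succ, add_comm]
    rfl

theorem ofFn_uncurry {α : Type*} {a b : ℕ} (F : Fin a → Fin b → α) :
    List.ofFn (fun p : Fin (a * b) => F (finProdFinEquiv.symm p).1 (finProdFinEquiv.symm p).2) =
      (List.ofFn F).flatMap List.ofFn := by
  simp only [List.ofFn_eq_map, finRange_mul, List.map_flatMap, List.flatMap_map, List.map_map,
    Function.comp_def, Equiv.symm_apply_apply]

namespace CounterProg

section Walk

variable {R : Type} (ι : Param → R)

/-- Writes the next block of the greedy path to the state of number `V`, and updates the state `u`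
of the path; the number of steps that are left after this one is `l`. -/
def walkStep (V l u : R) : CounterProg R :=
  letIn (chooseBlock ι V l u) (seq (putFixed .output (some (ι .d)) none)
    (assign (some u) (lookup (fun p => some (ι p)) (some u) none)))

def walk (V u : R) : CounterProg R :=
  letIn (addTo (some (ι .m)) none)
    (loop (.pos none) (walkStep (fun p => some (ι p)) (some V) none (some u)))

variable {ι} {E : RunEnv} {w d m s : ℕ} {Q : Automaton w d} {q : Fin w} {x : BitString s}
  (hE : E.HasInstance m Q q x)
  {Sim : Automaton (w * m) d × Fin (w * m) → BitString s → Fin (w * m)}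
  (hSim : IsOracleFor E.oracle Sim) {V u : R} (hι : ∀ p, ι p ≠ u) (hVu : V ≠ u) {t : Fin (w * m)}
include hE hSim

theorem runs_walkStep {σ : CounterState R} (hσ : σ.Loaded w d m s ι) (hσ' : σ.oracleTape = [])
    (hV : σ.reg V = t) {l : R} {k : Fin m} (hl : σ.reg l = k) {v : Fin w} (hu : σ.reg u = v) :
    let block := bitStringOfNat d (Q.greedyBlock (hitCount Sim Q t) k v)
    (walkStep ι V l u).Runs E σ ((σ.emit .output (List.ofFn block)).set u (Q v block)) := by
  intro block
  let z := Q.greedyBlock (hitCount Sim Q t) k v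
  have hz : z < 2 ^ d := Q.greedyBlock_lt (hitCount Sim Q t) k v
  have hd := hσ.reg_eq .d
  refine .letIn (k := z) (evals_chooseBlock hE hSim hσ hσ' hV hl hu) (.seq (runs_putFixed _ ?_ ?_)
    ((runs_assign (n := Q v block) (evals_lookup hE ((hσ.push z).emit_output _)
      (u := some u) (z := none) hu hz) ?_).of_eq ?_))
  · simpa [hd] using hE.value_le .d
  · exact hz.le.trans (hE.value_le .blocks)
  · exact (Q v block).isLt.le.trans (hE.value_le .w)
  · simp [hd, block, z, ofFn_bitStringOfNat, Param.value]

include hι hVu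

theorem runs_loop_walkStep {n : ℕ} (hn : n ≤ m) {σ : CounterState R} (hσ : σ.Loaded w d m s ι)
    (hσ' : σ.oracleTape = []) (hV : σ.reg V = t) {v : Fin w} (hu : σ.reg u = v) :
    ∃ k, (loop (.pos none) (walkStep (fun p => some (ι p)) (some V) none (some u))).Runs E
      (σ.push n) (((σ.emit .output ((List.ofFn (Q.greedyBlocks (hitCount Sim Q t) n v)).flatMap
        List.ofFn)).set u k).push 0) := by
  induction n generalizing σ v with
  | zero =>
    refine ⟨v, (Runs.loop_done (by simp [CounterTest.holds])).of_eq ?_⟩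
    simp [CounterTest.after, ← hu]
  | succ n ih =>
    let block := bitStringOfNat d (Q.greedyBlock (hitCount Sim Q t) n v)
    obtain ⟨k, hrest⟩ := ih (Nat.le_of_succ_le hn)
      (σ := (σ.emit .output (List.ofFn block)).set u (Q v block)) (v := Q v block)
      ((hσ.emit_output _).set hι _) hσ' (by simpa [hVu] using hV) (by simp)
    have hstep := runs_walkStep (V := some V) (u := some u) (l := none) (k := ⟨n, hn⟩) hE hSim
      (hσ.push n) hσ' hV rfl hu
    refine ⟨k, .loop_step (by simp [CounterTest.holds]) ?_ (hrest.of_eq ?_)⟩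
    · simpa [CounterTest.after] using hstep
    · simp [Automaton.greedyBlocks, block]

theorem runs_walk {σ : CounterState R} (hσ : σ.Loaded w d m s ι) (hσ' : σ.oracleTape = [])
    (hV : σ.reg V = t) {v : Fin w} (hu : σ.reg u = v) :
    ∃ k, (walk ι V u).Runs E σ ((σ.emit .output ((List.ofFn
      (Q.greedyBlocks (hitCount Sim Q t) m v)).flatMap List.ofFn)).set u k) := by
  obtain ⟨k, hloop⟩ := runs_loop_walkStep hE hSim hι hVu le_rfl hσ hσ' hV hu
  have hm := hσ.reg_eq .m
  have hcopy := evals_addTo (E := E) (σ := σ) (a := ι .m) (by rw [hm]; exact hE.value_le .m)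
  rw [hm] at hcopy
  exact ⟨k, .letIn hcopy hloop⟩

end Walk

section Generator

def loadParams : CounterProg Param :=
  seq (assign .w (readField (const 0))) (seq (assign .d (readField (const 1)))
    (seq (assign .m (readField (const 2))) (seq (assign .s (readField (const 3)))
      (seq (assign .blocks (powTwo .d)) (assign .seeds (powTwo .s))))))

/-- The expression for the index of the `k`-th field of the input after the transition table. -/
def indexAfterTable {R : Type} (ι : Param → R) (k : ℕ) : CounterProg (Option R) :=
  seq (const (4 + k)) (mulAddTo (some (ι .w)) (some (ι .blocks)) none)

/-- The program that computes `greedyGen`. The counters that it declares hold the start state `q`,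
the seed number, the start state of the layered automaton, and the state that is reached in the
simulation. -/
def generator : CounterProg Param :=
  seq loadParams (letIn (readField (indexAfterTable id 0))
    (letIn (readField (indexAfterTable some 1))
      (letIn (mulAddTo (some (some none)) (some (some (some .m))) none)
        (letIn (askSim (fun p => some (some (some p))) true none (some none))
          (walk (fun p => some (some (some (some p)))) none (some (some (some none))))))))

variable {E : RunEnv} {w d m s : ℕ} {Q : Automaton w d} {q : Fin w} {x : BitString s}
  (hE : E.HasInstance m Q q x)
include hE

theorem runs_assign_readField {σ : CounterState Param} (hσ : σ.inputHead = 0) {j : ℕ} {p : Param}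
    (hj : (inputFields m s Q q)[j]? = some (p.value w d m s)) (hjb : j ≤ 3) :
    (assign p (readField (const j))).Runs E σ (σ.set p (p.value w d m s)) := by
  have hwm := hE.states_mul_layers_le
  have hp := hE.eight_mul_value_le p
  exact runs_assign (evals_readField hj (hE.input_eq.trans (encodeInput_eq x)) hσ
    (evals_const (by omega)) (by omega)) (by omega)

theorem runs_loadParams : loadParams.Runs E .zero ⟨Param.value w d m s, 0, [], []⟩ := by
  refine .seq (runs_assign_readField hE rfl (p := .w) rfl (by norm_num)) (.seq
    (runs_assign_readField hE rfl (p := .d) rfl (by norm_num)) (.seq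
    (runs_assign_readField hE rfl (p := .m) rfl (by norm_num)) (.seq
    (runs_assign_readField hE rfl (p := .s) rfl (by norm_num)) (.seq
    (runs_assign (evals_powTwo ?_ ?_) ?_) ((runs_assign (evals_powTwo ?_ ?_) ?_).of_eq ?_)))))
  · simpa using hE.value_le .d
  · simpa [Param.value] using hE.value_le .blocks
  · simpa [Param.value] using hE.value_le .blocks
  · simpa using hE.value_le .s
  · simpa [Param.value] using hE.value_le .seeds
  · simpa [Param.value] using hE.value_le .seeds
  · ext p
    · cases p <;> simp [CounterState.zero, Param.value]
    all_goals rfl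

theorem evals_indexAfterTable {R : Type} {σ : CounterState R} {ι : Param → R}
    (hσ : σ.Loaded w d m s ι) {k : ℕ} (hk : k ≤ 1) :
    (indexAfterTable ι k).Evals E σ (4 + k + w * 2 ^ d) := by
  have hw := hσ.reg_eq .w
  have hB := hσ.reg_eq .blocks
  have hbound := hE.states_mul_blocks_le
  have hpos := Nat.two_pow_pos d
  simp only [Param.value, add_one_mul] at hw hB hbound
  refine .seq (evals_const (n := 4 + k) (by omega)) ((runs_mulAddTo (by simp) ?_ ?_).of_eq ?_)
  · simpa [hw, Param.value] using hE.value_le .w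
  · simpa [hw, hB] using (by omega : 4 + k + w * 2 ^ d ≤ E.bound)
  · simp [hw, hB]

theorem evals_readState {R : Type} {σ : CounterState R} {ι : Param → R}
    (hσ : σ.Loaded w d m s ι) : (readField (indexAfterTable ι 0)).Evals E σ q := by
  have hw := hE.eight_mul_value_le .w
  have hq : (q : ℕ) < w := q.isLt
  simp only [Param.value] at hw
  exact evals_readField inputFields_getElem?_state (hE.input_eq.trans (encodeInput_eq x))
    hσ.inputHead_eq (evals_indexAfterTable hE hσ zero_le_one) (by omega)

theorem evals_readSeed {R : Type} {σ : CounterState R} {ι : Param → R}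
    (hσ : σ.Loaded w d m s ι) :
    (readField (indexAfterTable ι 1)).Evals E σ (Nat.ofBits x) := by
  rw [← binVal_ofFn]
  refine evals_readField_bits (hE.input_eq.trans (encodeInput_eq x)) (.inl rfl) hσ.inputHead_eq
    ?_ (by simpa [Param.value] using hE.value_le .seeds)
  simpa [length_inputFields] using evals_indexAfterTable hE hσ le_rfl

theorem evals_startCopy (hm : 0 < m) {R : Type} {σ : CounterState R} {ι : Param → R}
    (hσ : σ.Loaded w d m s ι) {u : R} {v : Fin w} (hu : σ.reg u = v) :
    (mulAddTo (some u) (some (ι .m)) none).Evals E σ (finProdFinEquiv (v, (⟨0, hm⟩ : Fin m))) := by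
  have hreg := hσ.reg_eq .m
  have hbound := hE.states_mul_layers_le
  have hindex : (v : ℕ) * m ≤ w * m := Nat.mul_le_mul_right m v.isLt.le
  simp only [Param.value] at hreg
  refine (runs_mulAddTo (by simp) ?_ ?_).of_eq ?_
  · simpa [hu] using v.isLt.le.trans (hE.value_le .w)
  · simpa [hu, hreg] using (by omega : (v : ℕ) * m ≤ E.bound)
  · simp [hu, hreg, mul_comm]

theorem runs_generator (hm : 0 < m)
    {Sim : Automaton (w * m) d × Fin (w * m) → BitString s → Fin (w * m)}
    (hSim : IsOracleFor E.oracle Sim) : ∃ σ, generator.Runs E .zero σ ∧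
      σ.output = List.ofFn (greedyGen Sim (Q, q) x) := by
  let σ : CounterState Param := ⟨Param.value w d m s, 0, [], []⟩
  let start : Fin (w * m) := finProdFinEquiv (q, ⟨0, hm⟩)
  have hσ : σ.Loaded w d m s id := ⟨fun _ => rfl, rfl⟩
  have hσ₂ := (hσ.push q).push (Nat.ofBits x)
  have hseed : Nat.ofBits x ≤ E.bound := (Nat.ofBits_lt_two_pow x).le.trans (hE.value_le .seeds)
  have hstart := evals_startCopy hE hm hσ₂ (u := some none) (v := q) rfl
  have hsim := evals_askSim hE hSim (hσ₂.push start) rfl true (a := none) (y := some none)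
    (V := start) rfl hseed
  simp only [CounterState.reg_push_some, CounterState.reg_push_none, bitStringOfNat_ofBits] at hsim
  obtain ⟨k, hwalk⟩ := runs_walk hE hSim (ι := fun p => some (some (some (some p)))) (V := none)
    (u := some (some (some none))) (by simp) (by simp)
    ((hσ₂.push start).push (Sim (Q.layered true, start) x)) rfl rfl (v := q) rfl
  have hout := ofFn_uncurry (Q.greedyBlocks (hitCount Sim Q (Sim (Q.layered true, start) x)) m q)
  refine ⟨σ.emit .output (List.ofFn (greedyGen Sim (Q, q) x)), .seq (runs_loadParams hE)
    (.letIn (k := k) (evals_readState hE hσ) (.letIn (k := Nat.ofBits x)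
      (evals_readSeed hE (hσ.push q)) (.letIn (k := start) hstart
      (.letIn (k := Sim (Q.layered true, start) x) hsim (hwalk.of_eq ?_))))), ?_⟩
  · rw [← hout]
    simp only [CounterState.emit_push, CounterState.set_push_some, CounterState.set_push_none]
    rfl
  · simp [CounterState.emit, σ]

end Generator

end CounterProg

/-- The run of the generator on the instance `Q`, `q`, `x`, with the least bound on the counters
that is allowed. -/
def instanceEnv (f : List TapeSym → List Bool) {w d s : ℕ} (m : ℕ) (Q : Automaton w d) (q : Fin w)
    (x : BitString s) : RunEnv where
  oracle := f
  input := encodeInput m Q q x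
  bound := 8 * ((w + 1) * (m + 1)) * (2 ^ d * 2 ^ s)

theorem space_instanceEnv_le (f : List TapeSym → List Bool) {w d s : ℕ} (m : ℕ) (Q : Automaton w d)
    (q : Fin w) (x : BitString s) :
    (instanceEnv f m Q q x).space ≤ 9 * (s + d + Nat.log 2 w + Nat.log 2 m + 1) := by
  have hbound : (instanceEnv f m Q q x).bound ≤
      2 ^ (3 + (Nat.log 2 w + 1 + (Nat.log 2 m + 1)) + (d + s)) := by
    have hw : w + 1 ≤ 2 ^ (Nat.log 2 w + 1) := Nat.lt_pow_succ_log_self one_lt_two w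
    have hm : m + 1 ≤ 2 ^ (Nat.log 2 m + 1) := Nat.lt_pow_succ_log_self one_lt_two m
    rw [pow_add, pow_add 2 3, pow_add 2 (Nat.log 2 w + 1), pow_add 2 d]
    exact Nat.mul_le_mul_right _ (Nat.mul_le_mul_left _ (Nat.mul_le_mul hw hm))
  have hlog := Nat.log_mono_right (b := 2) hbound
  rw [Nat.log_pow one_lt_two] at hlog
  simp only [RunEnv.space]
  omega

theorem machine_generator_computes {f : List TapeSym → List Bool} {w d m s : ℕ} (hm : 0 < m)
    {Sim : Automaton (w * m) d × Fin (w * m) → BitString s → Fin (w * m)}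
    (hf : IsOracleFor f Sim) (Q : Automaton w d) (q : Fin w) (x : BitString s) :
    CounterProg.generator.machine.Computes f (encodeInput m Q q x)
        (List.ofFn (greedyGen Sim (Q, q) x)) ∧
      CounterProg.generator.machine.UsesSpaceAtMost f (encodeInput m Q q x)
        (9 * (s + d + Nat.log 2 w + Nat.log 2 m + 1)) := by
  let E := instanceEnv f m Q q x
  have hE : E.HasInstance m Q q x := ⟨rfl, le_rfl⟩
  have hpos : 0 < E.bound := by
    have hvalue := hE.value_le .blocks
    exact (Nat.two_pow_pos d).trans_le hvalue
  obtain ⟨σ, hrun, hout⟩ := CounterProg.runs_generator hE hm hf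
  obtain ⟨hcomputes, hspace⟩ := hrun.machine_computes hpos
  exact ⟨hout ▸ hcomputes,
    fun c hc t => (hspace c hc t).trans_le (space_instanceEnv_le f m Q q x)⟩

theorem mainTheorem3_general :
    ∃ (G : LLMachine) (C : ℕ), ∀ (w d m s : ℕ), 0 < m → ∀ (ε : ℝ)
      (Sim : Automaton (w * m) d × Fin (w * m) → BitString s → Fin (w * m)),
      IsSimulator ε (automatonClass (w * m) d m) Sim →
      ∀ f : List TapeSym → List Bool, IsOracleFor f Sim →
      ∃ Gen : Automaton w d × Fin w → BitString s → BitString (m * d),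
        IsTargetedPRG (2 * m * w * ε) (automatonClass w d m) Gen ∧
        ∀ (Q : Automaton w d) (q : Fin w) (x : BitString s),
          G.Computes f (encodeInput m Q q x) (List.ofFn (Gen (Q, q) x)) ∧
          G.UsesSpaceAtMost f (encodeInput m Q q x)
            (C * (s + d + Nat.log 2 w + Nat.log 2 m + 1)) :=
  ⟨CounterProg.generator.machine, 9, fun _ _ _ _ hm _ Sim hSim _ hf =>
    ⟨greedyGen Sim, isTargetedPRG_greedyGen hm hSim, machine_generator_computes hm hf⟩⟩

theorem mainTheorem3 :
    ∃ (G : LLMachine) (C : ℕ), ∀ (w d m s : ℕ), 0 < m → ∀ (ε : ℝ)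
      (Sim : Automaton (w * m) d × Fin (w * m) → BitString s → Fin (w * m)),
      IsSimulator ε (automatonClass (w * m) d m) Sim →
      ∀ f : List TapeSym → List Bool, IsOracleFor f Sim →
      ∃ Gen : Automaton w d × Fin w → BitString s → BitString (m * d),
        IsTargetedPRG (2 * m * w ^ 2 * ε) (automatonClass w d m) Gen ∧
        ∀ (Q : Automaton w d) (q : Fin w) (x : BitString s),
          G.Computes f (encodeInput m Q q x) (List.ofFn (Gen (Q, q) x)) ∧
          G.UsesSpaceAtMost f (encodeInput m Q q x)
            (C * (s + d + Nat.log 2 w + Nat.log 2 m + 1)) := by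
  obtain ⟨G, C, hG⟩ := mainTheorem3_general
  refine ⟨G, C, fun w d m s hm ε Sim hSim f hf => ?_⟩
  obtain ⟨Gen, hGen, hcomputes⟩ := hG w d m s hm ε Sim hSim f hf
  have herror : 2 * m * w ^ 2 * ε = w * (2 * m * w * ε) := by ring
  exact ⟨Gen, herror ▸ hGen.natCast_mul, hcomputes⟩
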